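/- Let $\mathcal H_F$ be the fermionic Fock space over $\mathbb C$ with its basis of semi-infinite monomials, indexed by the sets $S\subset\mathbb Z$ that differ from $\{k<0\}$ by finitely many elements, on which the fermions $\psi_k$ and $\psi^*_k$ ($k\in\mathbb Z$), satisfying $[\psi_m,\psi_n]_+=[\psi^*_m,\psi^*_n]_+=0$ and $[\psi_m,\psi^*_n]_+=\delta_{mn}$, act by adding, respectively removing, $k$ (up to sign). The vacuum $|n\rangle$ corresponds to $\{k<n\}$, so that $\psi_n|n\rangle=|n+1\rangle$, $\psi_m|n\rangle=0$ for $m<n$ and $\psi^*_m|n\rangle=0$ for $m\ge n$; $\langle n|$ is the dual vacuum. Put $\psi(z)=\sum_k\psi_kz^k$ and $\psi^*(z)=\sum_k\psi^*_kz^{-k}$, where $z$ is a formal variable. Let $J_k=\sum_{j\in\mathbb Z}:\!\psi_j\psi^*_{j+k}\!:$, with normal ordering with respect to $|0\rangle$, let $Q=J_0$ be the charge operator and $e^{\pm P}$ the shift operators ($S\mapsto S\pm1$ on basis states, so $e^{\pm P}|n\rangle=|n\pm1\rangle$). Put $J_+(\mathbf t)=\sum_{k\ge1}t_kJ_k$ and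 $J_\pm([x])=\sum_{k\ge1}\frac{x^k}{k}J_{\pm k}$. Let $\mathcal H_B=\mathbb C[w,w^{-1},t_1,t_2,\dots]$, and for $|U\rangle\in\mathcal H_F$ let $$\Phi(|U\rangle)=\sum_{l\in\mathbb Z}w^l\langle l|e^{J_+(\mathbf t)}|U\rangle .$$ Then this sum is finite, its coefficients are polynomials in the $t_k$ (so $\Phi$ maps $\mathcal H_F$ to $\mathcal H_B$), and for all $|U\rangle\in\mathcal H_F$ the following hold. 1. Currents: $\Phi(J_k|U\rangle)=\partial_{t_k}\Phi(|U\rangle)$ for $k>0$, $\Phi(J_0|U\rangle)=w\,\partial_w\Phi(|U\rangle)$, and $\Phi(J_k|U\rangle)=-k\,t_{-k}\,\Phi(|U\rangle)$ for $k<0$. 2. Vertex operators: as identities of formal series in $z$ with coefficients in $\mathcal H_B$, $$\Phi(\psi(z)|U\rangle)=X(z)\Phi(|U\rangle),\qquad \Phi(\psi^*(z)|U\rangle)=X^*(z)\Phi(|U\rangle),$$ where, with $\xi(\mathbf t,z)=\sum_{j\ge1}t_jz^j$, $\xi(\tilde\partial,z^{-1})=\sum_{j\ge1}\frac{z^{-j}}{j}\partial_{t_j}$,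 $e^{\pm P}f(w)=w^{\pm1}f(w)$ and $z^{\pm Q}f(w)=f(z^{\pm1}w)$, $$X(z)=e^{\xi(\mathbf t,z)}e^{-\xi(\tilde\partial,z^{-1})}e^Pz^Q,\qquad X^*(z)=e^{-\xi(\mathbf t,z)}e^{\xi(\tilde\partial,z^{-1})}z^{-Q}e^{-P},$$ and these products are well defined on $\mathcal H_B$: applied to any element, every coefficient of every power of $z$ is a finite sum. 3. Bosonization: as formal series in $z$ of operators on $\mathcal H_F$, $$\psi(z)=e^{J_-([z])}\,e^Pz^Q\,e^{-J_+([z^{-1}])},\qquad \psi^*(z)=e^{-J_-([z])}\,z^{-Q}e^{-P}\,e^{J_+([z^{-1}])},$$ where the products are well defined in the same sense. 4. Left vacua: for every $n\in\mathbb Z$, $$\langle n|\psi(z)=z^{n-1}\langle n-1|e^{-J_+([z^{-1}])},\qquad \langle n|\psi^*(z)=z^{-n}\langle n+1|e^{J_+([z^{-1}])}.$$ -/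

import Mathlib

noncomputable section

namespace BosonFermion

open scoped Nat

/-! ### Formal series -/

section Formal

/-- `exp f = ∑ fⁿ / n!` for a formal power series `f` without constant term, with coefficients in a
not necessarily commutative algebra. Powers `n > |d|` do not contribute to the coefficient at `d`. -/
def formalExp {σ A : Type*} [Ring A] [Algebra ℂ A] (f : MvPowerSeries σ A) : MvPowerSeries σ A :=
  fun d => ∑ n ∈ Finset.range (d.degree + 1), ((n ! : ℂ)⁻¹) • MvPowerSeries.coeff d (f ^ n)

/-- `ξ(a, x) = ∑_{k ≥ 1} a_k x ^ k`. -/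
def xi {A : Type*} [Ring A] (a : ℕ+ → A) : PowerSeries A :=
  PowerSeries.mk fun n => if h : 0 < n then a ⟨n, h⟩ else 0

/-- The series `f(z)`, as a formal distribution `∑_{m ∈ ℤ} f_m z ^ m`. -/
def atZ {A : Type*} [Ring A] (f : PowerSeries A) (m : ℤ) : A :=
  if 0 ≤ m then PowerSeries.coeff m.toNat f else 0

/-- The series `f(z⁻¹)`, as a formal distribution `∑_{m ∈ ℤ} f_m z ^ m`. -/
def atZInv {A : Type*} [Ring A] (f : PowerSeries A) (m : ℤ) : A :=
  atZ f (-m)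

variable {V : Type*} [AddCommGroup V] [Module ℂ V]

/-- The action of a formal distribution of operators `A(z) = ∑ A_a z ^ a` on a formal distribution
of vectors `u(z) = ∑ u_b z ^ b`: the coefficient of `z ^ m` is `∑_a A_a u_{m - a}`. It is meaningful
if `Composable A u` holds. -/
def act (A : ℤ → Module.End ℂ V) (u : ℤ → V) (m : ℤ) : V :=
  ∑ᶠ a : ℤ, A a (u (m - a))

/-- All the sums in `A(z) u(z)` are finite. -/
def Composable (A : ℤ → Module.End ℂ V) (u : ℤ → V) : Prop :=
  ∀ m : ℤ, (Function.support fun a : ℤ => A a (u (m - a))).Finite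

/-- A vector, as a constant series in `z`. -/
def const (v : V) : ℤ → V := Pi.single 0 v

/-- `A(z) B(z) C(z) v`. -/
def prod₃ (A B C : ℤ → Module.End ℂ V) (v : V) : ℤ → V :=
  act A (act B (act C (const v)))

/-- `A(z) B(z) C(z) v` is well defined for every `v`. -/
def WellDefined₃ (A B C : ℤ → Module.End ℂ V) : Prop :=
  ∀ v : V, Composable C (const v) ∧ Composable B (act C (const v)) ∧
    Composable A (act B (act C (const v)))

end Formal

/-! ### The fermionic Fock space -/

/-- Sets of integers that contain all sufficiently small integers and no sufficiently large ones
(equivalently, that differ from `{k | k < 0}` by a finite set). They index the basis states. -/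
def Maya : Type := {S : Set ℤ // ∃ a b : ℤ, Set.Iio a ⊆ S ∧ S ⊆ Set.Iio b}

namespace Maya

/-- `{k | k < n}`. -/
def vac (n : ℤ) : Maya := ⟨Set.Iio n, n, n, subset_rfl, subset_rfl⟩

def insert (k : ℤ) (S : Maya) : Maya :=
  ⟨Insert.insert k S.1, by
    obtain ⟨a, b, ha, hb⟩ := S.2
    refine ⟨a, max b (k + 1), fun x hx => Or.inr (ha hx), ?_⟩
    rintro x (rfl | hx)
    · simp
    · have := hb hx
      simp only [Set.mem_Iio] at this ⊢; omega⟩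

def erase (k : ℤ) (S : Maya) : Maya :=
  ⟨S.1 \ {k}, by
    obtain ⟨a, b, ha, hb⟩ := S.2
    refine ⟨min a k, b, fun x hx => ?_, fun x hx => hb hx.1⟩
    rw [Set.mem_Iio, lt_min_iff] at hx
    exact ⟨ha hx.1, ne_of_lt hx.2⟩⟩

/-- `S + n`. -/
def shift (n : ℤ) (S : Maya) : Maya :=
  ⟨{j | j - n ∈ S.1}, by
    obtain ⟨a, b, ha, hb⟩ := S.2
    refine ⟨a + n, b + n, fun x hx => ha ?_, fun x hx => ?_⟩
    · simp only [Set.mem_Iio] at hx ⊢; omega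
    · have := hb hx
      simp only [Set.mem_Iio] at this ⊢; omega⟩

/-- The charge with respect to the vacuum `{k | k < 0}`. -/
def charge (S : Maya) : ℤ :=
  ((S.1 ∩ Set.Ici 0).ncard : ℤ) - ((Set.Iio 0 \ S.1).ncard : ℤ)

/-- The number of elements of `S` that are greater than `k`. -/
def above (k : ℤ) (S : Maya) : ℕ := (S.1 ∩ Set.Ioi k).ncard

end Maya

/-- The fermionic Fock space `H_F`, with basis the semi-infinite monomials
`ψ_{s₁} ψ_{s₂} ψ_{s₃} ⋯` for `S = {s₁ > s₂ > s₃ > ⋯}` in `Maya`. -/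
abbrev Fock : Type := Maya →₀ ℂ

/-- The basis state of `S`. -/
def ket (S : Maya) : Fock := Finsupp.single S 1

/-- The dual vacuum `⟨n|`, the functional dual to the basis state `|n⟩ = ket (Maya.vac n)`. -/
def bra (n : ℤ) : Fock →ₗ[ℂ] ℂ := Finsupp.lapply (Maya.vac n)

/-- The linear operator on `H_F` with prescribed values on the basis states. -/
def ofBasis (f : Maya → Fock) : Module.End ℂ Fock := Finsupp.linearCombination ℂ f

open Classical in
/-- The fermion `ψ_k`: it adds `k` to `S`, with the sign from moving `ψ_k` to its place. -/
def psi (k : ℤ) : Module.End ℂ Fock :=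
  ofBasis fun S => if k ∈ S.1 then 0 else ((-1 : ℂ) ^ S.above k) • ket (S.insert k)

open Classical in
/-- The fermion `ψ*_k`: it removes `k` from `S`, with the sign from moving `ψ_k` to the front. -/
def psiStar (k : ℤ) : Module.End ℂ Fock :=
  ofBasis fun S => if k ∈ S.1 then ((-1 : ℂ) ^ S.above k) • ket (S.erase k) else 0

/-- `ψ(z) U = ∑_k ψ_k U z ^ k`. -/
def psiField (U : Fock) (m : ℤ) : Fock := psi m U

/-- `ψ*(z) U = ∑_k ψ*_k U z ^ (-k)`. -/
def psiStarField (U : Fock) (m : ℤ) : Fock := psiStar (-m) U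

/-- The normally ordered product of `ψ_j` and `ψ*_l` with respect to `|0⟩`: the factors are
exchanged, with a sign, when `ψ_j` is an annihilation operator (`j < 0`) and `ψ*_l` a creation
operator (`l < 0`). -/
def normalOrdered (j l : ℤ) : Module.End ℂ Fock :=
  if j < 0 ∧ l < 0 then -(psiStar l * psi j) else psi j * psiStar l

theorem psi_ket_of_mem {k : ℤ} {S : Maya} (h : k ∈ S.1) : psi k (ket S) = 0 := by
  simp [psi, ofBasis, ket, h]

theorem psiStar_ket_of_notMem {k : ℤ} {S : Maya} (h : k ∉ S.1) : psiStar k (ket S) = 0 := by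
  simp [psiStar, ofBasis, ket, h]

theorem psi_psiStar_ket_of_mem {j l : ℤ} {S : Maya} (h : j ∈ S.1) (hjl : j ≠ l) :
    psi j (psiStar l (ket S)) = 0 := by
  by_cases hl : l ∈ S.1
  · have : psiStar l (ket S) = ((-1 : ℂ) ^ S.above l) • ket (S.erase l) := by
      simp [psiStar, ofBasis, ket, hl]
    rw [this, map_smul, psi_ket_of_mem (S := S.erase l) ⟨h, hjl⟩, smul_zero]
  · rw [psiStar_ket_of_notMem hl, map_zero]

theorem psiStar_psi_ket_of_notMem {j l : ℤ} {S : Maya} (h : l ∉ S.1) (hjl : l ≠ j) :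
    psiStar l (psi j (ket S)) = 0 := by
  by_cases hj : j ∈ S.1
  · rw [psi_ket_of_mem hj, map_zero]
  · have : psi j (ket S) = ((-1 : ℂ) ^ S.above j) • ket (S.insert j) := by
      simp [psi, ofBasis, ket, hj]
    rw [this, map_smul, psiStar_ket_of_notMem (S := S.insert j), smul_zero]
    rintro (h' | h')
    · exact hjl h'
    · exact h h'

/-- On each state only finitely many terms of the current are non-zero. -/
theorem normalOrdered_support_finite (k : ℤ) (U : Fock) :
    (Function.support fun j : ℤ => normalOrdered j (j + k) U).Finite := by
  induction U using Finsupp.induction_linear with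
  | zero => simp
  | add U V hU hV =>
    simp only [map_add]
    exact (hU.union hV).subset (Function.support_add _ _)
  | single S c =>
    obtain ⟨a, b, ha, hb⟩ := S.2
    refine (Set.finite_Icc (min (min a 0) (a - k)) (max (max b 0) (b - k))).subset ?_
    intro j hj
    by_contra hout
    apply hj
    have hs : (Finsupp.single S c : Fock) = c • ket S := by simp [ket]
    have hlow : j < a → j ∈ S.1 := fun h => ha h
    have hlow' : j + k < a → j + k ∈ S.1 := fun h => ha h
    have hup : b ≤ j → j ∉ S.1 := fun h h' => absurd (hb h') (not_lt.mpr h)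
    have hup' : b ≤ j + k → j + k ∉ S.1 := fun h h' => absurd (hb h') (not_lt.mpr h)
    simp only [Set.mem_Icc, not_and_or, not_le] at hout
    simp only [hs, map_smul]
    suffices h : normalOrdered j (j + k) (ket S) = 0 by rw [h, smul_zero]
    unfold normalOrdered
    split_ifs with hc
    · simp only [LinearMap.neg_apply, Module.End.mul_apply, neg_eq_zero]
      rcases hout with hout | hout
      · rw [psi_ket_of_mem (hlow (by omega)), map_zero]
      · omega
    · simp only [Module.End.mul_apply]
      rcases hout with hout | hout
      · rcases eq_or_ne k 0 with rfl | hk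
        · omega
        · exact psi_psiStar_ket_of_mem (hlow (by omega)) (by omega)
      · rw [psiStar_ket_of_notMem (hup' (by omega)), map_zero]

/-- The current component `J_k`, the sum over `j` of the normally ordered `ψ_j ψ*_{j+k}`. -/
def J (k : ℤ) : Module.End ℂ Fock where
  toFun U := ∑ᶠ j : ℤ, normalOrdered j (j + k) U
  map_add' U V := by
    simp only [map_add]
    exact finsum_add_distrib (normalOrdered_support_finite k U) (normalOrdered_support_finite k V)
  map_smul' c U := by
    simp only [map_smul, RingHom.id_apply]
    rw [smul_finsum' _ (normalOrdered_support_finite k U)]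

/-- The charge operator `Q = J_0` has eigenvalue `S.charge` on the basis state of `S`. -/
theorem J_zero_ket (S : Maya) : J 0 (ket S) = (S.charge : ℂ) • ket S := by
  classical
  have hins : ∀ j, j ∉ S.1 → psiStar j (psi j (ket S)) = ket S := by
    intro j hj
    have h1 : psi j (ket S) = ((-1 : ℂ) ^ S.above j) • ket (S.insert j) := by
      simp [psi, ofBasis, ket, hj]
    have hmem : j ∈ (S.insert j).1 := Or.inl rfl
    have h2 : psiStar j (ket (S.insert j)) =
        ((-1 : ℂ) ^ (S.insert j).above j) • ket ((S.insert j).erase j) := by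
      simp [psiStar, ofBasis, ket, hmem]
    have h3 : (S.insert j).erase j = S := Subtype.ext (Set.insert_sdiff_self_of_notMem hj)
    have h4 : (S.insert j).above j = S.above j := by
      unfold Maya.above Maya.insert
      congr 1
      ext x
      simp only [Set.mem_inter_iff, Set.mem_insert_iff, Set.mem_Ioi]
      constructor
      · rintro ⟨rfl | h, h'⟩
        · exact absurd h' (lt_irrefl _)
        · exact ⟨h, h'⟩
      · exact fun h => ⟨Or.inr h.1, h.2⟩
    rw [h1, map_smul, h2, h3, h4, smul_smul, ← mul_pow]
    simp
  have hera : ∀ j, j ∈ S.1 → psi j (psiStar j (ket S)) = ket S := by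
    intro j hj
    have h1 : psiStar j (ket S) = ((-1 : ℂ) ^ S.above j) • ket (S.erase j) := by
      simp [psiStar, ofBasis, ket, hj]
    have hmem : j ∉ (S.erase j).1 := fun h => h.2 rfl
    have h2 : psi j (ket (S.erase j)) =
        ((-1 : ℂ) ^ (S.erase j).above j) • ket ((S.erase j).insert j) := by
      simp [psi, ofBasis, ket, hmem]
    have h3 : (S.erase j).insert j = S :=
      Subtype.ext (by simp [Maya.erase, Maya.insert, Set.insert_eq_of_mem hj])
    have h4 : (S.erase j).above j = S.above j := by
      unfold Maya.above Maya.erase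
      congr 1
      ext x
      simp only [Set.mem_inter_iff, Set.mem_sdiff, Set.mem_singleton_iff, Set.mem_Ioi]
      exact ⟨fun h => ⟨h.1.1, h.2⟩, fun h => ⟨⟨h.1, h.2.ne'⟩, h.2⟩⟩
    rw [h1, map_smul, h2, h3, h4, smul_smul, ← mul_pow]
    simp
  obtain ⟨a, b, ha, hb⟩ := S.2
  have hf1 : (S.1 ∩ Set.Ici 0).Finite :=
    (Set.finite_Ico 0 b).subset fun x hx => ⟨hx.2, hb hx.1⟩
  have hf2 : (Set.Iio 0 \ S.1).Finite :=
    (Set.finite_Ico a 0).subset fun x hx => ⟨not_lt.mp fun h => hx.2 (ha h), hx.1⟩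
  have hterm : ∀ j : ℤ, normalOrdered j (j + 0) (ket S) =
      (Set.indicator (S.1 ∩ Set.Ici 0) (fun _ => ket S) j) +
        (Set.indicator (Set.Iio 0 \ S.1) (fun _ => -ket S) j) := by
    intro j
    rw [add_zero]
    unfold normalOrdered
    by_cases hj : j ∈ S.1 <;> by_cases h0 : j < 0
    · have : ¬ (0 ≤ j) := not_le.mpr h0
      simp [h0, hj, this, psi_ket_of_mem hj]
    · simp [h0, hj, not_lt.mp h0, hera j hj]
    · have : ¬ (0 ≤ j) := not_le.mpr h0
      simp [h0, hj, hins j hj]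
    · simp [h0, hj, psiStar_ket_of_notMem hj]
  have hsum : ∀ (T : Set ℤ) (v : Fock), T.Finite →
      ∑ᶠ j : ℤ, Set.indicator T (fun _ => v) j = (T.ncard : ℂ) • v := by
    intro T v hT
    rw [← finsum_mem_def, finsum_mem_eq_finite_toFinset_sum _ hT, Finset.sum_const,
      Set.ncard_eq_toFinset_card _ hT, Nat.cast_smul_eq_nsmul]
  change ∑ᶠ j : ℤ, normalOrdered j (j + 0) (ket S) = _
  simp only [hterm]
  rw [finsum_add_distrib (hf1.subset Set.support_indicator_subset)
    (hf2.subset Set.support_indicator_subset), hsum _ _ hf1, hsum _ _ hf2, Maya.charge]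
  push_cast
  rw [smul_neg, sub_smul, sub_eq_add_neg]

/-- The shift operator `e^{nP}`. -/
def expP (n : ℤ) : Module.End ℂ Fock := ofBasis fun S => ket (S.shift n)

/-- The projection of `H_F` onto the states of charge `c`, so that `z ^ Q = ∑_c z ^ c chargeProj c`
for the charge operator `Q`. -/
def chargeProj (c : ℤ) : Module.End ℂ Fock :=
  ofBasis fun S => if S.charge = c then ket S else 0

/-- `e^P z ^ Q`. -/
def expP_zQ (m : ℤ) : Module.End ℂ Fock := expP 1 * chargeProj m

/-- `z ^ (-Q) e^{-P}`. -/
def zQ_expP (m : ℤ) : Module.End ℂ Fock := chargeProj (-m) * expP (-1)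

/-- `J_+([x]) = ∑_{k ≥ 1} J_k x ^ k / k`. -/
def Jplus : PowerSeries (Module.End ℂ Fock) := xi fun k => ((k : ℂ)⁻¹) • J k

/-- `J_-([x]) = ∑_{k ≥ 1} J_{-k} x ^ k / k`. -/
def Jminus : PowerSeries (Module.End ℂ Fock) := xi fun k => ((k : ℂ)⁻¹) • J (-k)

/-- The normally ordered exponential of the bosonic field `φ(z)`, that is
`e^{J_-([z])} e^P z^Q e^{-J_+([z⁻¹])}`, applied to a state. -/
def expPhi (U : Fock) : ℤ → Fock :=
  prod₃ (atZ (formalExp Jminus)) expP_zQ (atZInv (formalExp (-Jplus))) U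

/-- The normally ordered exponential of `-φ(z)`, that is
`e^{-J_-([z])} z^{-Q} e^{-P} e^{J_+([z⁻¹])}`, applied to a state. -/
def expNegPhi (U : Fock) : ℤ → Fock :=
  prod₃ (atZ (formalExp (-Jminus))) zQ_expP (atZInv (formalExp Jplus)) U

/-! ### The bosonic Fock space -/

/-- `H_B = ℂ[w, w⁻¹, t₁, t₂, …]`; the variable `w` is `LaurentPolynomial.T 1`. -/
abbrev BosonFock : Type := LaurentPolynomial (MvPolynomial ℕ+ ℂ)

/-- The variable `t_k`, as an element of `H_B`. -/
def time (k : ℕ+) : BosonFock := LaurentPolynomial.C (MvPolynomial.X k)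

/-- Multiplication by `t_k`. -/
def mulTime (k : ℕ+) : Module.End ℂ BosonFock := LinearMap.mulLeft ℂ (time k)

/-- `∂ / ∂t_k`. -/
def dTime (k : ℕ+) : Module.End ℂ BosonFock where
  toFun f := AddMonoidAlgebra.ofCoeff (f.coeff.mapRange (MvPolynomial.pderiv k) (map_zero _))
  map_add' f g := by ext; simp
  map_smul' c f := by ext; simp

/-- `w ∂ / ∂w`. -/
def wdw (f : BosonFock) : BosonFock :=
  f.coeff.sum fun l p => (l : ℂ) • (LaurentPolynomial.C p * LaurentPolynomial.T l)

/-- The operator `e^{nP}`: multiplication by `w ^ n`. -/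
def bExpP (n : ℤ) : Module.End ℂ BosonFock := LinearMap.mulLeft ℂ (LaurentPolynomial.T n)

/-- The projection of `H_B` onto `w ^ c ℂ[t₁, t₂, …]`. The operator `z ^ Q : f(w) ↦ f(zw)` is
`∑_c z ^ c wProj c`. -/
def wProj (c : ℤ) : Module.End ℂ BosonFock where
  toFun f := LaurentPolynomial.C (f.coeff c) * LaurentPolynomial.T c
  map_add' f g := by simp [add_mul]
  map_smul' a f := by
    ext; simp [← LaurentPolynomial.single_eq_C_mul_T, Finsupp.single_apply]

/-- `e^P z ^ Q`. -/
def bExpP_zQ (m : ℤ) : Module.End ℂ BosonFock := bExpP 1 * wProj m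

/-- `z ^ (-Q) e^{-P}`. -/
def bzQ_expP (m : ℤ) : Module.End ℂ BosonFock := wProj (-m) * bExpP (-1)

/-- `ξ(t, x) = ∑_{k ≥ 1} t_k x ^ k`, as multiplication operators. -/
def xiTime : PowerSeries (Module.End ℂ BosonFock) := xi mulTime

/-- `ξ(∂̃, x) = ∑_{k ≥ 1} (1 / k) ∂_{t_k} x ^ k`. -/
def xiD : PowerSeries (Module.End ℂ BosonFock) := xi fun k => ((k : ℂ)⁻¹) • dTime k

/-- The vertex operator `X(z) = e^{ξ(t, z)} e^{-ξ(∂̃, z⁻¹)} e^P z^Q`, applied to `f`. -/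
def vertexX (f : BosonFock) : ℤ → BosonFock :=
  prod₃ (atZ (formalExp xiTime)) (atZInv (formalExp (-xiD))) bExpP_zQ f

/-- The vertex operator `X*(z) = e^{-ξ(t, z)} e^{ξ(∂̃, z⁻¹)} z^{-Q} e^{-P}`, applied to `f`. -/
def vertexXStar (f : BosonFock) : ℤ → BosonFock :=
  prod₃ (atZ (formalExp (-xiTime))) (atZInv (formalExp xiD)) bzQ_expP f

/-! ### The boson-fermion correspondence -/

open Classical in
/-- `J_+(t) = ∑_{k ≥ 1} t_k J_k`, a formal power series in the times: its coefficient at the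
monomial `t_k` is `J_k` and its other coefficients vanish. -/
def JplusTimes : MvPowerSeries ℕ+ (Module.End ℂ Fock) :=
  fun d => ∑ k ∈ d.support, if d = Finsupp.single k 1 then J k else 0

/-- `⟨l| e^{J_+(t)} |U⟩`, as a formal power series in the times. -/
def amplitude (l : ℤ) (U : Fock) : MvPowerSeries ℕ+ ℂ :=
  fun d => bra l (MvPowerSeries.coeff d (formalExp JplusTimes) U)

/-- `Φ(U) = ∑_l w ^ l ⟨l| e^{J_+(t)} |U⟩`, summed over the monomials `w ^ l t ^ d`. -/
def Phi (U : Fock) : BosonFock :=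
  ∑ᶠ p : ℤ × (ℕ+ →₀ ℕ), LaurentPolynomial.C
    (MvPolynomial.monomial p.2 (MvPowerSeries.coeff p.2 (amplitude p.1 U))) *
      LaurentPolynomial.T p.1

end BosonFermion

end

noncomputable section

namespace BosonFermion

open scoped Nat

/-! ### Formal exponentials -/

section FormalExp

open MvPowerSeries

variable {σ A : Type*} [Ring A]

/-! An operator field on `Fock` is pinned down by its commutators with the currents `J k`, `k > 0`,
and by its products with the left vacua. The anticommutation relations give `[J_k, ψ(z)] = z^k
ψ(z)`, `[J_k, ψ*(z)] = -z^k ψ*(z)` and the Heisenberg relations (`J_mul_J`).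

Exponentials rest on one rule: `D (exp f) = (D f) exp f` for a derivation `D` with `D f` commuting
with `f` (`IsLeibniz.map_formalExp`). Euler operators `D` give recursions for the coefficients,
inner derivations give commutators. Together with `⟨l| J_{-k} = 0` this yields the action of the
currents under `Φ`.

The formulas for `⟨n| ψ(z)` and `⟨n| ψ*(z)` (`bra_psi_eq`, `bra_psiStar_eq`) follow by strong
induction from the recursion: the unwanted terms form a double sum that is antisymmetric by the
fermionic relations.

`Φ` is injective (`Phi_injective`): its kernel is stable under `J_k`, `k > 0`, hence by the left
vacuum formula under every `ψ*_m`, and removing particles turns any coefficient of a vector into a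
vacuum coefficient. So a field with `[J_k, F(z)] = ε z^k F(z)` is determined by all `⟨n| F(z)`
(`eq_prod₃_of_bra`). Both sides of each bosonization formula have the same such data, so they agree.

The vertex operators are the images under `Φ` of the bosonized fields. `Φ` is surjective, so
finiteness and commutation pass from `Fock` to `BosonFock`. Finiteness on `Fock` comes from a
nonnegative energy that `J_k` lowers by `k`. -/

theorem coeff_pow_eq_zero {f : MvPowerSeries σ A} (h0 : constantCoeff f = 0) {d : σ →₀ ℕ} {n : ℕ}
    (h : d.degree < n) : coeff d (f ^ n) = 0 :=
  coeff_of_lt_order (lt_of_lt_of_le (by exact_mod_cast h)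
    (le_order_pow_of_constantCoeff_eq_zero n h0))

theorem commute_of_coeff {f g : MvPowerSeries σ A}
    (h : ∀ d e, Commute (coeff d f) (coeff e g)) : Commute f g := by
  classical
  ext d
  rw [coeff_mul, coeff_mul, Finsupp.sum_antidiagonal_swap d fun a b => coeff a f * coeff b g]
  exact Finset.sum_congr rfl fun p _ => (h _ _).eq

variable [Algebra ℂ A]

/-- Later truncation adds only zero terms, so coefficients of different degrees can be summed over
one common range. -/
theorem coeff_formalExp {f : MvPowerSeries σ A} (h0 : constantCoeff f = 0) (d : σ →₀ ℕ) {N : ℕ}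
    (h : d.degree < N) :
    coeff d (formalExp f) = ∑ n ∈ Finset.range N, ((n ! : ℂ)⁻¹) • coeff d (f ^ n) := by
  refine Finset.sum_subset (Finset.range_subset_range.2 h) fun n _ hn => ?_
  rw [coeff_pow_eq_zero h0 (by simpa using hn), smul_zero]

theorem coeff_zero_formalExp (f : MvPowerSeries σ A) : coeff 0 (formalExp f) = 1 := by
  classical
  change ∑ n ∈ Finset.range ((0 : σ →₀ ℕ).degree + 1), ((n ! : ℂ)⁻¹) • coeff 0 (f ^ n) = 1
  simp

/-- An operation that acts on the coefficient at `d` by `δ d`. -/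
def coeffwise (δ : (σ →₀ ℕ) → A →ₗ[ℂ] A) (f : MvPowerSeries σ A) : MvPowerSeries σ A :=
  fun d => δ d (coeff d f)

@[simp]
theorem coeff_coeffwise (δ : (σ →₀ ℕ) → A →ₗ[ℂ] A) (f : MvPowerSeries σ A) (d : σ →₀ ℕ) :
    coeff d (coeffwise δ f) = δ d (coeff d f) := rfl

/-- The Leibniz rule for `coeffwise δ`. -/
def IsLeibniz (δ : (σ →₀ ℕ) → A →ₗ[ℂ] A) : Prop :=
  ∀ d e a b, δ (d + e) (a * b) = δ d a * b + a * δ e b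

theorem IsLeibniz.mul {δ : (σ →₀ ℕ) → A →ₗ[ℂ] A} (hδ : IsLeibniz δ) (f g : MvPowerSeries σ A) :
    coeffwise δ (f * g) = coeffwise δ f * g + f * coeffwise δ g := by
  classical
  ext d
  rw [coeff_coeffwise, map_add, coeff_mul, coeff_mul, coeff_mul, map_sum, ← Finset.sum_add_distrib]
  refine Finset.sum_congr rfl fun p hp => ?_
  rw [← Finset.HasAntidiagonal.mem_antidiagonal.1 hp, hδ]
  rfl

theorem IsLeibniz.pow {δ : (σ →₀ ℕ) → A →ₗ[ℂ] A} (hδ : IsLeibniz δ) {f : MvPowerSeries σ A}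
    (hf : Commute (coeffwise δ f) f) (n : ℕ) :
    coeffwise δ (f ^ (n + 1)) = (n + 1) • (coeffwise δ f * f ^ n) := by
  induction n with
  | zero => simp
  | succ n ih =>
    rw [pow_succ, hδ.mul, ih, smul_mul_assoc, mul_assoc, ← pow_succ, ← (hf.pow_right (n + 1)).eq,
      ← succ_nsmul]

theorem IsLeibniz.one {δ : (σ →₀ ℕ) → A →ₗ[ℂ] A} (hδ : IsLeibniz δ) :
    coeffwise δ (1 : MvPowerSeries σ A) = 0 := by
  have := hδ.mul (1 : MvPowerSeries σ A) 1
  simpa using this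

/-- `D (exp f) = (D f) exp f` if `D f` commutes with `f`. -/
theorem IsLeibniz.map_formalExp {δ : (σ →₀ ℕ) → A →ₗ[ℂ] A} (hδ : IsLeibniz δ) {f : MvPowerSeries σ A}
    (h0 : constantCoeff f = 0) (hf : Commute (coeffwise δ f) f) :
    coeffwise δ (formalExp f) = coeffwise δ f * formalExp f := by
  classical
  ext d
  -- One term beyond the necessary range: `D` kills the term `n = 0` and lowers the remaining
  -- exponents by one.
  rw [coeff_coeffwise, coeff_formalExp h0 d (N := d.degree + 1 + 1) (by omega), map_sum,
    Finset.sum_range_succ']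
  simp only [map_smul, ← coeff_coeffwise, hδ.pow hf, pow_zero, hδ.one, map_zero, smul_zero,
    add_zero]
  have h : coeff d (coeffwise δ f * formalExp f) =
      ∑ n ∈ Finset.range (d.degree + 1), ((n ! : ℂ)⁻¹) • coeff d (coeffwise δ f * f ^ n) := by
    simp only [coeff_mul, Finset.smul_sum]
    rw [Finset.sum_comm]
    refine Finset.sum_congr rfl fun p hp => ?_
    have hd : p.2.degree < d.degree + 1 := by
      rw [← Finset.HasAntidiagonal.mem_antidiagonal.1 hp, map_add]; omega
    rw [coeff_formalExp h0 p.2 hd, Finset.mul_sum]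
    exact Finset.sum_congr rfl fun n _ => mul_smul_comm ((n ! : ℂ)⁻¹) _ _
  rw [h]
  refine Finset.sum_congr rfl fun n _ => ?_
  rw [map_nsmul, ← Nat.cast_smul_eq_nsmul ℂ, smul_smul, Nat.factorial_succ]
  congr 1
  have : (n ! : ℂ) ≠ 0 := by exact_mod_cast n.factorial_ne_zero
  have : (n + 1 : ℂ) ≠ 0 := by exact_mod_cast n.succ_ne_zero
  push_cast
  field_simp

theorem commute_coeff_formalExp {x : A} {f : MvPowerSeries σ A}
    (h : ∀ d, Commute x (coeff d f)) (d : σ →₀ ℕ) : Commute x (coeff d (formalExp f)) := by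
  have hC : Commute (C x) f := by
    ext d
    rw [coeff_C_mul, coeff_mul_C, (h d).eq]
  change Commute x (∑ n ∈ Finset.range (d.degree + 1), ((n ! : ℂ)⁻¹) • coeff d (f ^ n))
  refine Commute.sum_right _ _ _ fun n _ => ?_
  have := congrArg (coeff d) (hC.pow_right n).eq
  rw [coeff_C_mul, coeff_mul_C] at this
  exact Commute.smul_right this ((n ! : ℂ)⁻¹)

/-- The operator `∑_d λ(d) t ^ d ∂ / ∂t ^ d`. -/
def euler (l : (σ →₀ ℕ) →+ ℕ) (d : σ →₀ ℕ) : A →ₗ[ℂ] A := (l d : ℂ) • LinearMap.id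

theorem isLeibniz_euler (l : (σ →₀ ℕ) →+ ℕ) : IsLeibniz (A := A) (euler l) := by
  intro d e a b
  simp [euler, add_smul]

/-- The commutator with `x`. -/
def ad (x : A) (_ : σ →₀ ℕ) : A →ₗ[ℂ] A := LinearMap.mulLeft ℂ x - LinearMap.mulRight ℂ x

theorem isLeibniz_ad (x : A) : IsLeibniz (σ := σ) (ad x) := by
  intro d e a b
  simp [ad, sub_mul, mul_sub, mul_assoc]

/-- Each coefficient of a power is a finite sum of products, so intertwining passes from `f` to its
powers. This carries exponentials of currents across `Φ`. -/
theorem intertwine_coeff_formalExp {V W : Type*} [AddCommGroup V] [Module ℂ V] [AddCommGroup W]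
    [Module ℂ W] (g : V →ₗ[ℂ] W) {f : MvPowerSeries σ (Module.End ℂ V)}
    {f' : MvPowerSeries σ (Module.End ℂ W)}
    (h : ∀ d v, g (coeff d f v) = coeff d f' (g v)) (d : σ →₀ ℕ) (v : V) :
    g (coeff d (formalExp f) v) = coeff d (formalExp f') (g v) := by
  classical
  have hpow : ∀ (n : ℕ) d v, g (coeff d (f ^ n) v) = coeff d (f' ^ n) (g v) := by
    intro n
    induction n with
    | zero =>
      intro d v
      simp only [pow_zero, coeff_one]
      split_ifs <;> simp
    | succ n ih =>
      intro d v
      simp only [pow_succ, coeff_mul, LinearMap.sum_apply, Module.End.mul_apply, map_sum, ih, h]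
  change g ((∑ n ∈ Finset.range (d.degree + 1), ((n ! : ℂ)⁻¹) • coeff d (f ^ n)) v) =
    (∑ n ∈ Finset.range (d.degree + 1), ((n ! : ℂ)⁻¹) • coeff d (f' ^ n)) (g v)
  simp [LinearMap.sum_apply, hpow]

end FormalExp

/-! ### Exponentials in one variable -/

section PowerSeriesExp

variable {A : Type*} [Ring A]

theorem atZ_of_neg (f : PowerSeries A) {m : ℤ} (h : m < 0) : atZ f m = 0 := by
  simp [atZ, not_le.2 h]

theorem coeff_xi (a : ℕ+ → A) (n : ℕ) :
    PowerSeries.coeff n (xi a) = if h : 0 < n then a ⟨n, h⟩ else 0 := by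
  simp [xi]

variable [Algebra ℂ A]

/-- The coefficient of `x ^ n` in `exp f`. -/
def expCoeff (f : PowerSeries A) (n : ℕ) : A := PowerSeries.coeff n (formalExp f : PowerSeries A)

theorem atZ_formalExp_natCast (f : PowerSeries A) (n : ℕ) :
    atZ (formalExp f) (n : ℤ) = expCoeff f n := by
  simp [atZ, expCoeff]

theorem expCoeff_zero (f : PowerSeries A) : expCoeff f 0 = 1 := by
  have := coeff_zero_formalExp (f : MvPowerSeries Unit A)
  rw [expCoeff, PowerSeries.coeff]
  simpa using this

theorem coeff_smul_xi_succ (ε : ℂ) (a : ℕ+ → A) (n : ℕ) :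
    PowerSeries.coeff (n + 1) (ε • xi a) = ε • a n.succPNat := by
  change ε • PowerSeries.coeff (n + 1) (xi a) = _
  rw [coeff_xi, dif_pos n.succ_pos]
  rfl

theorem coeff_smul_xi_zero (ε : ℂ) (a : ℕ+ → A) :
    PowerSeries.coeff 0 (ε • xi a) = 0 := by
  change ε • PowerSeries.coeff 0 (xi a) = _
  rw [coeff_xi]
  simp

theorem constantCoeff_smul_xi (ε : ℂ) (a : ℕ+ → A) :
    MvPowerSeries.constantCoeff (ε • xi a) = 0 := by
  rw [← MvPowerSeries.coeff_zero_eq_constantCoeff_apply, ← Finsupp.single_zero ()]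
  exact coeff_smul_xi_zero ε a

theorem forall_coeff_smul_xi {p : A → Prop} (ε : ℂ) (a : ℕ+ → A) (h0 : p 0)
    (h : ∀ k, p (ε • a k)) (d : Unit →₀ ℕ) : p (MvPowerSeries.coeff d (ε • xi a)) := by
  have hd : d = Finsupp.single () (d ()) := by ext; simp
  rw [hd]
  change p (PowerSeries.coeff (d ()) (ε • xi a))
  cases d () with
  | zero => rwa [coeff_smul_xi_zero]
  | succ n => rw [coeff_smul_xi_succ]; exact h _

theorem commute_expCoeff {x : A} {ε : ℂ} {a : ℕ+ → A} (h : ∀ k, Commute x (a k)) (n : ℕ) :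
    Commute x (expCoeff (ε • xi a) n) :=
  commute_coeff_formalExp (forall_coeff_smul_xi ε a (Commute.zero_right x)
    fun k => (h k).smul_right ε) _

/-- `m E_m = ε ∑_{k ≥ 1} k a_k E_{m - k}` for `∑ E_m x ^ m = exp (ε ∑ a_k x ^ k)`. -/
theorem expCoeff_rec {ε : ℂ} {a : ℕ+ → A} (h : ∀ k l, Commute (a k) (a l)) (m : ℕ) :
    (m : ℂ) • expCoeff (ε • xi a) m = ε • ∑ i ∈ Finset.range m,
      ((i + 1 : ℕ) : ℂ) • (a i.succPNat * expCoeff (ε • xi a) (m - 1 - i)) := by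
  -- With this weight the Euler operator is `x d/dx`.
  let l : (Unit →₀ ℕ) →+ ℕ := Finsupp.applyAddHom ()
  have hc : Commute (coeffwise (euler l) (ε • xi a)) (ε • xi a) := by
    refine commute_of_coeff fun d e => ?_
    rw [coeff_coeffwise, euler]
    refine Commute.smul_left ?_ _
    refine forall_coeff_smul_xi (p := fun b => Commute b _) ε a (Commute.zero_left _)
      (fun k => ?_) d
    refine forall_coeff_smul_xi (p := fun b => Commute _ b) ε a (Commute.zero_right _)
      (fun j => ?_) e
    exact ((h k j).smul_left ε).smul_right ε
  have key := (isLeibniz_euler l).map_formalExp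
    (constantCoeff_smul_xi ε a) hc
  have key := congrArg (PowerSeries.coeff m) key
  rw [PowerSeries.coeff_mul, Finset.Nat.sum_antidiagonal_eq_sum_range_succ_mk] at key
  have e1 : ∀ (f : PowerSeries A) n, PowerSeries.coeff n (coeffwise (euler l) f : PowerSeries A) =
      (n : ℂ) • PowerSeries.coeff n f := by
    intro f n
    rw [PowerSeries.coeff, coeff_coeffwise]
    simp [euler, l, PowerSeries.coeff]
  rw [e1] at key
  refine key.trans ?_
  rw [Finset.sum_range_succ', e1]
  simp only [e1, Nat.cast_zero, zero_smul, zero_mul, add_zero, coeff_smul_xi_succ, Finset.smul_sum]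
  refine Finset.sum_congr rfl fun i _ => ?_
  rw [smul_mul_assoc, smul_mul_assoc, smul_comm, show m - (i + 1) = m - 1 - i by omega]
  rfl

/-- If `x` commutes with all `a_i` but `a_k`, and `[x, a_k] = 1`, then `[x, exp (ε ∑ a_i x ^ i)]`
is `ε x ^ k exp (ε ∑ a_i x ^ i)`. -/
theorem commutator_expCoeff {ε : ℂ} {a : ℕ+ → A} {x : A} (k : ℕ+)
    (hx : ∀ i, x * a i - a i * x = if i = k then 1 else 0) (m : ℕ) :
    x * expCoeff (ε • xi a) m - expCoeff (ε • xi a) m * x =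
      if (k : ℕ) ≤ m then ε • expCoeff (ε • xi a) (m - k) else 0 := by
  -- Only the term `i = k` contributes; the result is a scalar series, so it commutes with
  -- everything.
  have e0 : coeffwise (ad x) (ε • xi a) = ε • (PowerSeries.X ^ (k : ℕ) : PowerSeries A) := by
    refine PowerSeries.ext fun n => ?_
    change x * PowerSeries.coeff n (ε • xi a) - PowerSeries.coeff n (ε • xi a) * x =
      ε • PowerSeries.coeff n (PowerSeries.X ^ (k : ℕ))
    rw [PowerSeries.coeff_X_pow]
    cases n with
    | zero => rw [coeff_smul_xi_zero, if_neg k.pos.ne]; simp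
    | succ n =>
      rw [coeff_smul_xi_succ, mul_smul_comm, smul_mul_assoc, ← smul_sub, hx]
      simp [← PNat.coe_inj]
  have hc : Commute (coeffwise (ad x) (ε • xi a)) (ε • xi a) := by
    rw [e0]
    exact Commute.smul_left (PowerSeries.commute_X_pow (ε • xi a) k).symm ε
  have key := (isLeibniz_ad x).map_formalExp
    (constantCoeff_smul_xi ε a) hc
  have key := congrArg (PowerSeries.coeff m) key
  rw [e0, smul_mul_assoc] at key
  refine key.trans ?_
  change ε • PowerSeries.coeff m (PowerSeries.X ^ (k : ℕ) * (formalExp (ε • xi a) : PowerSeries A))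
    = _
  rw [PowerSeries.coeff_X_pow_mul', smul_ite, smul_zero]
  rfl

theorem intertwine_expCoeff {V W : Type*} [AddCommGroup V] [Module ℂ V] [AddCommGroup W]
    [Module ℂ W] (g : V →ₗ[ℂ] W) {ε : ℂ} {a : ℕ+ → Module.End ℂ V} {b : ℕ+ → Module.End ℂ W}
    (h : ∀ k v, g (a k v) = b k (g v)) (n : ℕ) (v : V) :
    g (expCoeff (ε • xi a) n v) = expCoeff (ε • xi b) n (g v) := by
  refine intertwine_coeff_formalExp g (fun d v => ?_) _ v
  have hd : d = Finsupp.single () (d ()) := by ext; simp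
  rw [hd]
  change g (PowerSeries.coeff (d ()) (ε • xi a) v) = PowerSeries.coeff (d ()) (ε • xi b) (g v)
  cases d () with
  | zero => rw [coeff_smul_xi_zero, coeff_smul_xi_zero]; simp
  | succ n => rw [coeff_smul_xi_succ, coeff_smul_xi_succ]; simp [h]

end PowerSeriesExp

/-! ### Products of formal distributions of operators -/

section Act

variable {V W : Type*} [AddCommGroup V] [AddCommGroup W]

theorem const_support_finite (v : V) : (Function.support (const v)).Finite :=
  (Set.finite_singleton 0).subset Pi.support_single_subset

variable [Module ℂ V] [Module ℂ W]

/-- On each vector only finitely many coefficients of `A(z)` do not vanish. -/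
def LocallyFinite (A : ℤ → Module.End ℂ V) : Prop :=
  ∀ v, (Function.support fun m => A m v).Finite

theorem composable_of_finite (A : ℤ → Module.End ℂ V) {u : ℤ → V}
    (hu : (Function.support u).Finite) : Composable A u := by
  intro m
  refine (hu.image fun b => m - b).subset fun a ha => ⟨m - a, ?_, sub_sub_cancel m a⟩
  intro h
  apply ha
  simp [h]

theorem act_const (A : ℤ → Module.End ℂ V) (v : V) : act A (const v) = fun m => A m v := by
  funext m
  rw [act, finsum_eq_single _ m]
  · simp [const]
  · intro a ha
    rw [const, Pi.single_eq_of_ne (sub_ne_zero.2 ha.symm), map_zero]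

/-- The support lies in a finite union of translates of finite sets, one for each nonzero
coefficient of `u`. -/
theorem LocallyFinite.act_support_finite {A : ℤ → Module.End ℂ V} (hA : LocallyFinite A)
    {u : ℤ → V} (hu : (Function.support u).Finite) : (Function.support (act A u)).Finite := by
  refine (hu.biUnion fun b _ => (hA (u b)).image fun a => a + b).subset fun m hm => ?_
  obtain ⟨a, ha⟩ : ∃ a, A a (u (m - a)) ≠ 0 := by
    by_contra! h
    exact hm (finsum_eq_zero_of_forall_eq_zero h)
  refine Set.mem_biUnion (x := m - a) ?_ ⟨a, ha, add_sub_cancel a m⟩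
  intro h
  apply ha
  simp [h]

theorem LocallyFinite.act_act_const_support_finite {B C : ℤ → Module.End ℂ V}
    (hB : LocallyFinite B) (hC : LocallyFinite C) (v : V) :
    (Function.support (act B (act C (const v)))).Finite :=
  hB.act_support_finite (hC.act_support_finite (const_support_finite v))

/-- The two right factors turn a vector into a Laurent polynomial in `z`, on which any distribution
can act; hence no condition on `A`. -/
theorem wellDefined₃_of_locallyFinite (A : ℤ → Module.End ℂ V) {B C : ℤ → Module.End ℂ V}
    (hB : LocallyFinite B) (hC : LocallyFinite C) : WellDefined₃ A B C := fun v =>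
  ⟨composable_of_finite _ (const_support_finite v),
    composable_of_finite _ (hC.act_support_finite (const_support_finite v)),
    composable_of_finite _ (hB.act_act_const_support_finite hC v)⟩

theorem map_act (g : V →ₗ[ℂ] W) {A : ℤ → Module.End ℂ V} {B : ℤ → Module.End ℂ W}
    (h : ∀ a v, g (A a v) = B a (g v)) {u : ℤ → V} (hu : (Function.support u).Finite) (m : ℤ) :
    g (act A u m) = act B (fun b => g (u b)) m := by
  rw [act, act, ← LinearMap.toAddMonoidHom_coe,
    AddMonoidHom.map_finsum _ (composable_of_finite A hu m)]
  simp [h]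

theorem map_const (g : V →ₗ[ℂ] W) (v : V) : (fun m => g (const v m)) = const (g v) := by
  funext m
  by_cases hm : m = 0
  · subst hm; simp [const]
  · simp [const, hm]

theorem map_act_act_const (g : V →ₗ[ℂ] W) {B C : ℤ → Module.End ℂ V} {B' C' : ℤ → Module.End ℂ W}
    (hC : LocallyFinite C) (hBB' : ∀ a v, g (B a v) = B' a (g v))
    (hCC' : ∀ a v, g (C a v) = C' a (g v)) (v : V) :
    (fun m => g (act B (act C (const v)) m)) = act B' (act C' (const (g v))) := by
  funext m
  rw [map_act g hBB' (hC.act_support_finite (const_support_finite v))]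
  congr 1
  funext b
  rw [map_act g hCC' (const_support_finite v), map_const]

theorem map_prod₃ (g : V →ₗ[ℂ] W) {A B C : ℤ → Module.End ℂ V} {A' B' C' : ℤ → Module.End ℂ W}
    (hB : LocallyFinite B) (hC : LocallyFinite C) (hAA' : ∀ a v, g (A a v) = A' a (g v))
    (hBB' : ∀ a v, g (B a v) = B' a (g v)) (hCC' : ∀ a v, g (C a v) = C' a (g v)) (v : V)
    (m : ℤ) : g (prod₃ A B C v m) = prod₃ A' B' C' (g v) m := by
  rw [prod₃, map_act g hAA' (hB.act_act_const_support_finite hC v),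
    map_act_act_const g hC hBB' hCC', prod₃]

/-- Substitute `a ↦ m - a` in the convolution. It is needed because the vertex operators and the
bosonized fields list their right factors in opposite orders. -/
theorem act_act_const_comm {B C : ℤ → Module.End ℂ V} (h : ∀ a b, Commute (B a) (C b)) (v : V) :
    act B (act C (const v)) = act C (act B (const v)) := by
  funext m
  rw [act_const, act_const, act, act, ← finsum_comp_equiv (Equiv.subLeft m)]
  refine finsum_congr fun a => ?_
  rw [Equiv.subLeft_apply, sub_sub_cancel, ← Module.End.mul_apply, (h _ _).eq,
    Module.End.mul_apply]

theorem act_add_left (A B C : ℤ → Module.End ℂ V) {u : ℤ → V} (hu : (Function.support u).Finite)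
    (h : ∀ a, C a = A a + B a) (m : ℤ) : act C u m = act A u m + act B u m := by
  rw [act, act, act, ← finsum_add_distrib (composable_of_finite A hu m)
    (composable_of_finite B hu m)]
  simp [h]

theorem act_shift (A : ℤ → Module.End ℂ V) (u : ℤ → V) (k m : ℤ) :
    act (fun a => A (a - k)) u m = act A u (m - k) := by
  rw [act, act, ← finsum_comp_equiv (Equiv.addRight k)]
  simp [sub_add_eq_sub_sub, sub_right_comm]

theorem act_smul (c : ℂ) (A : ℤ → Module.End ℂ V) {u : ℤ → V} (hu : (Function.support u).Finite)
    (m : ℤ) : act (fun a => c • A a) u m = c • act A u m := by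
  rw [act, act, smul_finsum' _ (composable_of_finite A hu m)]
  rfl

/-- If `[x, A(z)] = ε z ^ k A(z)` and `x` commutes with `B(z)`, `C(z)`, then
`[x, A(z) B(z) C(z)] = ε z ^ k A(z) B(z) C(z)`. -/
theorem commutator_prod₃ {A B C : ℤ → Module.End ℂ V} (hB : LocallyFinite B)
    (hC : LocallyFinite C) {x : Module.End ℂ V} {ε : ℂ} {k : ℤ}
    (hA : ∀ a, x * A a - A a * x = ε • A (a - k)) (hxB : ∀ a, Commute x (B a))
    (hxC : ∀ a, Commute x (C a)) (v : V) (m : ℤ) :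
    x (prod₃ A B C v m) = prod₃ A B C (x v) m + ε • prod₃ A B C v (m - k) := by
  have hu := hB.act_act_const_support_finite hC v
  have hBC : (fun b => x (act B (act C (const v)) b)) = act B (act C (const (x v))) :=
    map_act_act_const x hC (fun a v => LinearMap.congr_fun (hxB a).eq v)
      (fun a v => LinearMap.congr_fun (hxC a).eq v) v
  rw [prod₃, prod₃, ← act_shift, ← act_smul _ _ hu, ← hBC]
  have h1 : x (act A (act B (act C (const v))) m) =
      act (fun a => x * A a) (act B (act C (const v))) m := by
    rw [act, ← LinearMap.toAddMonoidHom_coe,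
      AddMonoidHom.map_finsum _ (composable_of_finite A hu m)]
    rfl
  have h2 : act A (fun b => x (act B (act C (const v)) b)) m =
      act (fun a => A a * x) (act B (act C (const v))) m := rfl
  rw [h1, h2, ← act_add_left _ _ _ hu]
  intro a
  rw [← hA, add_sub_cancel]

end Act

/-! ### Fermions -/

section Fermions

open Classical

namespace Maya

theorem insert_val (k : ℤ) (S : Maya) : (S.insert k).1 = Insert.insert k S.1 := rfl

theorem erase_val (k : ℤ) (S : Maya) : (S.erase k).1 = S.1 \ {k} := rfl

theorem mem_insert {k j : ℤ} {S : Maya} : j ∈ (S.insert k).1 ↔ j = k ∨ j ∈ S.1 := Iff.rfl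

theorem mem_erase {k j : ℤ} {S : Maya} : j ∈ (S.erase k).1 ↔ j ∈ S.1 ∧ j ≠ k := Iff.rfl

theorem mem_vac {n j : ℤ} : j ∈ (vac n).1 ↔ j < n := Iff.rfl

theorem mem_shift {n j : ℤ} {S : Maya} : j ∈ (S.shift n).1 ↔ j - n ∈ S.1 := Iff.rfl

@[ext]
theorem ext {S T : Maya} (h : ∀ j, j ∈ S.1 ↔ j ∈ T.1) : S = T := Subtype.ext (Set.ext h)

theorem insert_erase {k : ℤ} {S : Maya} (h : k ∈ S.1) : (S.erase k).insert k = S := by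
  ext j
  rw [mem_insert, mem_erase]
  by_cases hj : j = k
  · simp [hj, h]
  · simp [hj]

theorem erase_insert {k : ℤ} {S : Maya} (h : k ∉ S.1) : (S.insert k).erase k = S := by
  ext j
  rw [mem_erase, mem_insert]
  by_cases hj : j = k
  · simp [hj, h]
  · simp [hj]

theorem inter_Ioi_finite (k : ℤ) (S : Maya) : (S.1 ∩ Set.Ioi k).Finite := by
  obtain ⟨a, b, ha, hb⟩ := S.2
  exact (Set.finite_Ioo k b).subset fun x hx => ⟨hx.2, hb hx.1⟩

/-- The sign `(-1) ^ |{s ∈ S | k < s}|`. -/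
def sign (k : ℤ) (S : Maya) : ℂ := (-1) ^ S.above k

theorem sign_mul_self (k : ℤ) (S : Maya) : S.sign k * S.sign k = 1 := by
  rw [sign, ← mul_pow]; simp

theorem sign_insert {j : ℤ} {S : Maya} (h : j ∉ S.1) (k : ℤ) :
    (S.insert j).sign k = if k < j then -S.sign k else S.sign k := by
  unfold sign above
  split_ifs with hk
  · have : (S.insert j).1 ∩ Set.Ioi k = Insert.insert j (S.1 ∩ Set.Ioi k) := by
      rw [insert_val, Set.insert_inter_of_mem (show j ∈ Set.Ioi k from hk)]
    rw [this, Set.ncard_insert_of_notMem (fun h' => h h'.1) (S.inter_Ioi_finite k), pow_succ]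
    ring
  · rw [insert_val, Set.insert_inter_of_notMem (show j ∉ Set.Ioi k from hk)]

theorem sign_erase {j : ℤ} {S : Maya} (h : j ∈ S.1) (k : ℤ) :
    (S.erase j).sign k = if k < j then -S.sign k else S.sign k := by
  have := sign_insert (S := S.erase j) (j := j) (fun h' => (mem_erase.1 h').2 rfl) k
  rw [insert_erase h] at this
  rw [this]
  split_ifs <;> simp

end Maya

theorem psi_ket (k : ℤ) (S : Maya) :
    psi k (ket S) = if k ∈ S.1 then 0 else S.sign k • ket (S.insert k) := by
  simp [psi, ofBasis, ket, Maya.sign]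

theorem psiStar_ket (k : ℤ) (S : Maya) :
    psiStar k (ket S) = if k ∈ S.1 then S.sign k • ket (S.erase k) else 0 := by
  simp [psiStar, ofBasis, ket, Maya.sign]

theorem expP_ket (n : ℤ) (S : Maya) : expP n (ket S) = ket (S.shift n) := by
  simp [expP, ofBasis, ket]

theorem chargeProj_ket (c : ℤ) (S : Maya) :
    chargeProj c (ket S) = if S.charge = c then ket S else 0 := by
  simp [chargeProj, ofBasis, ket]

theorem bra_ket (n : ℤ) (S : Maya) : bra n (ket S) = if S = Maya.vac n then 1 else 0 := by
  simp [bra, ket, Finsupp.single_apply]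

theorem fock_hom_ext {M : Type*} [AddCommMonoid M] [Module ℂ M] {f g : Fock →ₗ[ℂ] M}
    (h : ∀ S, f (ket S) = g (ket S)) : f = g := by
  refine Finsupp.lhom_ext fun S c => ?_
  have hs : (Finsupp.single S c : Fock) = c • ket S := by simp [ket]
  rw [hs, map_smul, map_smul, h]

/-- For `j ≠ k`, in exactly one of the two orders the second factor has to pass the element added by
the first, so the signs are opposite. -/
theorem psi_psi (j k : ℤ) : psi j * psi k = -(psi k * psi j) := by
  refine fock_hom_ext fun S => ?_
  rw [Module.End.mul_apply, LinearMap.neg_apply, Module.End.mul_apply, psi_ket, psi_ket]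
  rcases eq_or_ne j k with rfl | hjk
  · split_ifs with h
    · simp
    · simp [psi_ket, Maya.mem_insert]
  by_cases hj : j ∈ S.1 <;> by_cases hk : k ∈ S.1
  · simp [hj, hk]
  · simp [hj, hk, psi_ket, Maya.mem_insert]
  · simp [hj, hk, psi_ket, Maya.mem_insert]
  · have e : (S.insert k).insert j = (S.insert j).insert k := by
      ext i; simp only [Maya.mem_insert]; tauto
    simp only [hj, hk, if_false, map_smul, psi_ket, Maya.mem_insert, hjk, hjk.symm, or_self,
      Maya.sign_insert hj, Maya.sign_insert hk, e, smul_smul, ← neg_smul]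
    congr 1
    rcases lt_or_gt_of_ne hjk with h | h
    · simp [h, h.not_gt, mul_comm]
    · simp [h, h.not_gt, mul_comm]

theorem psiStar_psiStar (j k : ℤ) : psiStar j * psiStar k = -(psiStar k * psiStar j) := by
  refine fock_hom_ext fun S => ?_
  rw [Module.End.mul_apply, LinearMap.neg_apply, Module.End.mul_apply, psiStar_ket, psiStar_ket]
  rcases eq_or_ne j k with rfl | hjk
  · split_ifs with h
    · simp [psiStar_ket, Maya.mem_erase]
    · simp
  by_cases hj : j ∈ S.1 <;> by_cases hk : k ∈ S.1
  · have e : (S.erase k).erase j = (S.erase j).erase k := by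
      ext i; simp only [Maya.mem_erase]; tauto
    simp only [hj, hk, if_true, map_smul, psiStar_ket, Maya.mem_erase, hjk, hjk.symm, ne_eq,
      not_false_eq_true, and_self, Maya.sign_erase hj, Maya.sign_erase hk, e, smul_smul,
      ← neg_smul]
    congr 1
    rcases lt_or_gt_of_ne hjk with h | h
    · simp [h, h.not_gt, mul_comm]
    · simp [h, h.not_gt, mul_comm]
  · simp [hj, hk, psiStar_ket, Maya.mem_erase]
  · simp [hj, hk, psiStar_ket, Maya.mem_erase]
  · simp [hj, hk]

/-- For `j = k` one of the two terms vanishes on each basis state and the other carries a squared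
sign; for `j ≠ k` the two terms cancel as for two `ψ`s. -/
theorem psi_psiStar_add (j k : ℤ) :
    psi j * psiStar k + psiStar k * psi j = if j = k then 1 else 0 := by
  refine fock_hom_ext fun S => ?_
  rw [LinearMap.add_apply, Module.End.mul_apply, Module.End.mul_apply, psi_ket, psiStar_ket]
  rcases eq_or_ne j k with rfl | hjk
  · by_cases h : j ∈ S.1
    · simp [h, psi_ket, Maya.mem_erase, Maya.sign_erase h, smul_smul, Maya.sign_mul_self,
        Maya.insert_erase]
    · simp [h, psiStar_ket, Maya.mem_insert, Maya.sign_insert h, smul_smul, Maya.sign_mul_self,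
        Maya.erase_insert]
  by_cases hj : j ∈ S.1 <;> by_cases hk : k ∈ S.1
  · simp [hj, hk, hjk, psi_ket, Maya.mem_erase]
  · simp [hj, hk, hjk]
  · have e : (S.erase k).insert j = (S.insert j).erase k := by
      ext i; simp only [Maya.mem_erase, Maya.mem_insert]
      by_cases h : i = j
      · subst h; simp [hjk]
      · simp [h]
    simp only [hj, hk, if_true, if_false, map_smul, psi_ket, psiStar_ket, Maya.mem_erase,
      Maya.mem_insert, hjk, ne_eq, false_and, or_true,
      Maya.sign_erase hk, Maya.sign_insert hj, e, smul_smul, ← add_smul, LinearMap.zero_apply]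
    rcases lt_or_gt_of_ne hjk with h | h
    · simp [h, h.not_gt, mul_comm]
    · simp [h, h.not_gt, mul_comm]
  · simp [hj, hk, hjk, psiStar_ket, Maya.mem_insert, hjk.symm]

end Fermions

/-- A shortcut: unification does not find this instance where it is needed. -/
local instance endFockRing : Ring (Module.End ℂ Fock) := Module.End.instRing

/-! ### Currents -/

section Currents

theorem psiStar_psi (l j : ℤ) :
    psiStar l * psi j = (if j = l then 1 else 0) - psi j * psiStar l :=
  eq_sub_of_add_eq' (psi_psiStar_add j l)

theorem psi_psiStar (j l : ℤ) :
    psi j * psiStar l = (if j = l then 1 else 0) - psiStar l * psi j :=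
  eq_sub_of_add_eq (psi_psiStar_add j l)

/-- Normal ordering subtracts only the vacuum expectation value in `|0⟩`, a scalar, so commutators
with fermions can be computed from `ψ_j ψ*_l`. -/
theorem normalOrdered_eq (j l : ℤ) :
    normalOrdered j l = psi j * psiStar l - if j = l ∧ j < 0 then 1 else 0 := by
  unfold normalOrdered
  split_ifs with h h' h'
  · rw [psi_psiStar, if_pos h'.1]; abel
  · rw [psi_psiStar, if_neg fun e => h' ⟨e, h.1⟩]; abel
  · exact absurd ⟨h'.2, h'.1 ▸ h'.2⟩ h
  · rw [sub_zero]

theorem normalOrdered_mul_psi (i l j : ℤ) :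
    normalOrdered i l * psi j = psi j * normalOrdered i l + if l = j then psi i else 0 := by
  have h : psi i * psiStar l * psi j =
      psi j * (psi i * psiStar l) + if l = j then psi i else 0 := by
    rw [mul_assoc, psiStar_psi, mul_sub, ← mul_assoc, psi_psi i j, neg_mul, mul_assoc]
    by_cases hj : l = j
    · simp [hj]; abel
    · simp [hj, Ne.symm hj]
  rw [normalOrdered_eq, sub_mul, mul_sub, h]
  split_ifs <;> simp [sub_add_eq_add_sub]

theorem normalOrdered_mul_psiStar (i l j : ℤ) :
    normalOrdered i l * psiStar j =
      psiStar j * normalOrdered i l - if i = j then psiStar l else 0 := by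
  have h : psi i * psiStar l * psiStar j =
      psiStar j * (psi i * psiStar l) - if i = j then psiStar l else 0 := by
    rw [mul_assoc, psiStar_psiStar, mul_neg, ← mul_assoc, psi_psiStar i j, sub_mul, mul_assoc]
    by_cases hj : i = j
    · simp [hj]
    · simp [hj]
  rw [normalOrdered_eq, sub_mul, mul_sub, h]
  split_ifs <;> simp [sub_right_comm]

theorem J_apply (k : ℤ) (U : Fock) : J k U = ∑ᶠ j : ℤ, normalOrdered j (j + k) U := rfl

theorem map_J {M : Type*} [AddCommGroup M] [Module ℂ M] (g : Fock →ₗ[ℂ] M) (k : ℤ) (U : Fock) :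
    g (J k U) = ∑ᶠ j : ℤ, g (normalOrdered j (j + k) U) := by
  rw [J_apply, ← LinearMap.toAddMonoidHom_coe,
    AddMonoidHom.map_finsum _ (normalOrdered_support_finite k U)]

theorem map_normalOrdered_support_finite {M : Type*} [AddCommGroup M] [Module ℂ M]
    (g : Fock →ₗ[ℂ] M) (k : ℤ) (U : Fock) :
    (Function.support fun j : ℤ => g (normalOrdered j (j + k) U)).Finite := by
  refine (normalOrdered_support_finite k U).subset fun j hj h => hj ?_
  simp only at h ⊢
  rw [h, map_zero]

theorem ite_support_finite {M : Type*} [Zero M] (a k : ℤ) (f : ℤ → M) :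
    (Function.support fun j : ℤ => if j + k = a then f j else 0).Finite := by
  refine (Set.finite_singleton (a - k)).subset fun j hj => ?_
  by_contra h
  exact hj (if_neg fun h' => h (by simp [← h']))

theorem finsum_ite {M : Type*} [AddCommMonoid M] (a k : ℤ) (f : ℤ → M) :
    ∑ᶠ j : ℤ, (if j + k = a then f j else 0) = f (a - k) := by
  rw [finsum_eq_single _ (a - k)]
  · simp
  · intro j hj
    exact if_neg fun h' => hj (by simp [← h'])

theorem J_mul_psi (k j : ℤ) : J k * psi j = psi j * J k + psi (j - k) := by
  refine LinearMap.ext fun U => ?_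
  rw [LinearMap.add_apply, Module.End.mul_apply, Module.End.mul_apply, map_J, J_apply,
    ← finsum_ite j k fun i => psi i U, ← finsum_add_distrib
    (map_normalOrdered_support_finite (psi j) k U) (ite_support_finite j k _)]
  refine finsum_congr fun i => ?_
  rw [← Module.End.mul_apply, normalOrdered_mul_psi]
  split_ifs <;> simp

theorem J_mul_psiStar (k j : ℤ) : J k * psiStar j = psiStar j * J k - psiStar (j + k) := by
  refine LinearMap.ext fun U => ?_
  have := finsum_ite j 0 fun i => psiStar (i + k) U
  have hf := ite_support_finite j 0 fun i => psiStar (i + k) U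
  simp only [add_zero, sub_zero] at this hf
  rw [LinearMap.sub_apply, Module.End.mul_apply, Module.End.mul_apply, map_J, J_apply, ← this,
    ← finsum_sub_distrib (map_normalOrdered_support_finite (psiStar j) k U) hf]
  refine finsum_congr fun i => ?_
  rw [← Module.End.mul_apply, normalOrdered_mul_psiStar]
  split_ifs <;> simp

/-- The signed count of the integers between `0` and `m`. It is the central term of the Heisenberg
relations. -/
theorem finsum_indicator_sub {M : Type*} [AddCommGroup M] [Module ℂ M] (m : ℤ) (v : M) :
    ∑ᶠ i : ℤ, ((if i < m then v else 0) - if i < 0 then v else 0) = (m : ℂ) • v := by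
  rw [finsum_eq_sum_of_support_subset (s := Finset.Ico (min m 0) (max m 0))]
  · rcases le_total 0 m with h | h
    · rw [min_eq_right h, max_eq_left h, Finset.sum_congr rfl (g := fun _ => v)]
      · rw [Finset.sum_const, Int.card_Ico, ← Nat.cast_smul_eq_nsmul ℂ, sub_zero]
        congr 1
        exact_mod_cast Int.toNat_of_nonneg h
      · intro i hi
        rw [Finset.mem_Ico] at hi
        rw [if_pos hi.2, if_neg (not_lt.2 hi.1), sub_zero]
    · rw [min_eq_left h, max_eq_right h, Finset.sum_congr rfl (g := fun _ => -v)]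
      · rw [Finset.sum_const, Int.card_Ico, ← Nat.cast_smul_eq_nsmul ℂ, smul_neg, ← neg_smul]
        congr 1
        have : ((0 - m).toNat : ℤ) = -m := by omega
        have : ((0 - m).toNat : ℂ) = -m := by exact_mod_cast this
        rw [this, neg_neg]
      · intro i hi
        rw [Finset.mem_Ico] at hi
        rw [if_pos hi.2, if_neg (not_lt.2 hi.1), zero_sub]
  · intro i hi
    rw [Finset.mem_coe, Finset.mem_Ico]
    by_contra hc
    apply hi
    rcases lt_or_ge i m with h1 | h1 <;> rcases lt_or_ge i 0 with h2 | h2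
    · simp [h1, h2]
    · omega
    · omega
    · simp [h1.not_gt, h2.not_gt]

/-- The Heisenberg commutation relations. -/
theorem J_mul_J (m n : ℤ) :
    J m * J n - J n * J m = if m + n = 0 then (m : ℂ) • 1 else 0 := by
  refine LinearMap.ext fun U => ?_
  -- The commutator is `ψ_{i-m} ψ*_{i+n} - ψ_i ψ*_{i+n+m}`. Normal ordering both products leaves a
  -- difference of scalars, nonzero only when `m + n = 0`.
  have hterm : ∀ i : ℤ, J m (normalOrdered i (i + n) U) = normalOrdered i (i + n) (J m U) +
      (normalOrdered (i - m) (i - m + (m + n)) U - normalOrdered i (i + (m + n)) U) +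
      if m + n = 0 then ((if i < m then U else 0) - if i < 0 then U else 0) else 0 := by
    intro i
    have h1 : J m * (psi i * psiStar (i + n)) = psi i * psiStar (i + n) * J m +
        (psi (i - m) * psiStar (i + n) - psi i * psiStar (i + n + m)) := by
      rw [← mul_assoc, J_mul_psi, add_mul, mul_assoc, J_mul_psiStar, mul_sub, mul_assoc]
      abel
    have h2 : J m * normalOrdered i (i + n) = normalOrdered i (i + n) * J m +
        (psi (i - m) * psiStar (i + n) - psi i * psiStar (i + n + m)) := by
      rw [normalOrdered_eq, mul_sub, sub_mul, h1]
      split_ifs <;> simp <;> abel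
    have h3 := LinearMap.congr_fun h2 U
    rw [Module.End.mul_apply] at h3
    rw [h3, ← Module.End.mul_apply (normalOrdered i (i + n)), normalOrdered_eq (i - m),
      normalOrdered_eq i (i + (m + n)),
      show i - m + (m + n) = i + n by ring, show i + n + m = i + (m + n) by ring]
    by_cases h0 : m + n = 0
    · have e1 : i - m = i + n := by omega
      have e2 : i = i + (m + n) := by omega
      rw [if_pos h0, if_congr (and_iff_right e1) rfl rfl, if_congr (and_iff_right e2) rfl rfl,
        if_congr (sub_neg (a := i) (b := m)) rfl rfl]
      by_cases h1 : i < m <;> by_cases h2 : i < 0 <;>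
        simp only [h1, h2, if_true, if_false, LinearMap.add_apply, LinearMap.sub_apply,
          Module.End.one_apply, LinearMap.zero_apply] <;> abel
    · have e1 : i - m ≠ i + n := by omega
      have e2 : i ≠ i + (m + n) := by omega
      simp [e1, e2, h0]
  have hf := normalOrdered_support_finite (m + n) U
  -- Once normally ordered, the two sums are separately finite and cancel after shifting the index
  -- by `m`; only the scalars remain.
  have hs : ∑ᶠ i : ℤ, normalOrdered (i - m) (i - m + (m + n)) U =
      ∑ᶠ i : ℤ, normalOrdered i (i + (m + n)) U :=
    finsum_comp_equiv (Equiv.subRight m) (f := fun i => normalOrdered i (i + (m + n)) U)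
  have hf' : (Function.support fun i : ℤ =>
      normalOrdered (i - m) (i - m + (m + n)) U).Finite :=
    hf.preimage (f := fun i => i - m) (sub_left_injective.injOn)
  have hg : (Function.support fun i : ℤ =>
      if m + n = 0 then ((if i < m then U else 0) - if i < 0 then U else 0) else 0).Finite := by
    refine (Set.finite_Icc (min m 0) (max m 0)).subset fun i hi => ?_
    rw [Set.mem_Icc]
    by_contra hc
    apply hi
    rcases lt_or_ge i m with h1 | h1 <;> rcases lt_or_ge i 0 with h2 | h2
    · simp [h1, h2]
    · omega
    · omega
    · simp [h1.not_gt, h2.not_gt]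
  rw [LinearMap.sub_apply, Module.End.mul_apply, Module.End.mul_apply, map_J,
    finsum_congr hterm, finsum_add_distrib _ hg,
    finsum_add_distrib (normalOrdered_support_finite n _), finsum_sub_distrib hf' hf, hs, sub_self,
    add_zero, ← J_apply, add_sub_cancel_left]
  · split_ifs with h
    · rw [finsum_indicator_sub]; rfl
    · simp
  · exact (hf'.union hf).subset (Function.support_sub _ _)
  · exact ((normalOrdered_support_finite n _).union
      ((hf'.union hf).subset (Function.support_sub _ _))).subset (Function.support_add _ _)

theorem J_commute {m n : ℤ} (h : m + n ≠ 0) : Commute (J m) (J n) := by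
  have := J_mul_J m n
  rw [if_neg h] at this
  exact sub_eq_zero.1 this

theorem normalOrdered_of_ne {j l : ℤ} (h : j ≠ l) : normalOrdered j l = psi j * psiStar l := by
  rw [normalOrdered_eq, if_neg fun h' => h h'.1, sub_zero]

theorem J_apply_of_ne_zero {k : ℤ} (hk : k ≠ 0) (U : Fock) :
    J k U = ∑ᶠ j : ℤ, psi j (psiStar (j + k) U) := by
  rw [J_apply]
  refine finsum_congr fun j => ?_
  rw [normalOrdered_of_ne (by omega)]
  rfl

theorem Maya.sign_shift (n k : ℤ) (S : Maya) : (S.shift n).sign (k + n) = S.sign k := by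
  unfold Maya.sign Maya.above
  congr 1
  rw [← Set.ncard_image_of_injective (S.1 ∩ Set.Ioi k) (add_left_injective n)]
  congr 1
  ext x
  simp only [Set.mem_inter_iff, Maya.mem_shift, Set.mem_Ioi, Set.mem_image]
  constructor
  · rintro ⟨h1, h2⟩
    exact ⟨x - n, ⟨h1, by omega⟩, by omega⟩
  · rintro ⟨y, ⟨h1, h2⟩, rfl⟩
    exact ⟨by simpa using h1, by omega⟩

theorem expP_mul_psi (n k : ℤ) : expP n * psi k = psi (k + n) * expP n := by
  classical
  refine fock_hom_ext fun S => ?_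
  rw [Module.End.mul_apply, Module.End.mul_apply, psi_ket, expP_ket, psi_ket, Maya.mem_shift,
    add_sub_cancel_right]
  split_ifs
  · simp
  · rw [map_smul, expP_ket, Maya.sign_shift]
    congr 2
    ext j
    simp only [Maya.mem_shift, Maya.mem_insert]
    exact or_congr_left sub_eq_iff_eq_add

theorem expP_mul_psiStar (n k : ℤ) : expP n * psiStar k = psiStar (k + n) * expP n := by
  classical
  refine fock_hom_ext fun S => ?_
  rw [Module.End.mul_apply, Module.End.mul_apply, psiStar_ket, expP_ket, psiStar_ket,
    Maya.mem_shift, add_sub_cancel_right]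
  split_ifs
  · rw [map_smul, expP_ket, Maya.sign_shift]
    congr 2
    ext j
    simp only [Maya.mem_shift, Maya.mem_erase]
    exact and_congr_right fun _ => not_congr sub_eq_iff_eq_add
  · simp

/-- The shift relabels the terms of the current. For `k ≠ 0` there is no normal ordering constant,
which a shift would not preserve. -/
theorem J_commute_expP {k : ℤ} (hk : k ≠ 0) (n : ℤ) : Commute (J k) (expP n) := by
  refine LinearMap.ext fun U => ?_
  rw [Module.End.mul_apply, Module.End.mul_apply, map_J, J_apply_of_ne_zero hk,
    ← finsum_comp_equiv (Equiv.addRight n)]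
  refine finsum_congr fun j => ?_
  rw [normalOrdered_of_ne (by omega), ← Module.End.mul_apply, ← Module.End.mul_apply,
    ← Module.End.mul_apply, ← mul_assoc, expP_mul_psi, mul_assoc, mul_assoc, expP_mul_psiStar,
    Equiv.coe_addRight, add_right_comm]

theorem J_zero_apply (U : Fock) (S : Maya) : J 0 U S = S.charge * U S := by
  have : Finsupp.lapply S ∘ₗ J 0 = (S.charge : ℂ) • Finsupp.lapply S := by
    refine fock_hom_ext fun T => ?_
    rw [LinearMap.comp_apply, J_zero_ket]
    by_cases h : T = S
    · simp [h]
    · simp [ket, Finsupp.single_eq_of_ne' h]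
  exact LinearMap.congr_fun this U

theorem chargeProj_apply (c : ℤ) (U : Fock) (S : Maya) :
    chargeProj c U S = if S.charge = c then U S else 0 := by
  have : Finsupp.lapply S ∘ₗ chargeProj c =
      if S.charge = c then (Finsupp.lapply S : Fock →ₗ[ℂ] ℂ) else 0 := by
    refine fock_hom_ext fun T => ?_
    rw [LinearMap.comp_apply, chargeProj_ket]
    by_cases h : T = S
    · subst h; split_ifs <;> simp
    · split_ifs <;> simp [ket, Finsupp.single_eq_of_ne' h]
  have := LinearMap.congr_fun this U
  simp only [LinearMap.comp_apply, Finsupp.lapply_apply] at this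
  rw [this]
  split_ifs <;> simp

/-- `J 0` is diagonal with the charges as eigenvalues, so the matrix entries of `T` between states
of different charge vanish. -/
theorem commute_chargeProj {T : Module.End ℂ Fock} (hT : Commute (J 0) T) (c : ℤ) :
    Commute T (chargeProj c) := by
  refine fock_hom_ext fun S => ?_
  rw [Module.End.mul_apply, Module.End.mul_apply, chargeProj_ket]
  refine Finsupp.ext fun R => ?_
  rw [chargeProj_apply]
  have h : (R.charge : ℂ) * T (ket S) R = S.charge * T (ket S) R := by
    have := LinearMap.congr_fun hT.eq (ket S)
    rw [Module.End.mul_apply, Module.End.mul_apply, J_zero_ket, map_smul] at this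
    rw [← J_zero_apply, this]
    rfl
  rw [mul_eq_mul_right_iff, Int.cast_inj] at h
  rcases h with h | h
  · rw [h]; split_ifs <;> simp
  · rw [h]; split_ifs <;> simp [h]

theorem J_commute_chargeProj (k c : ℤ) : Commute (J k) (chargeProj c) := by
  refine commute_chargeProj ?_ c
  rcases eq_or_ne k 0 with rfl | hk
  · exact Commute.refl _
  · exact J_commute (by omega)

theorem Maya.charge_vac (n : ℤ) : (Maya.vac n).charge = n := by
  have h1 : (Maya.vac n).1 ∩ Set.Ici 0 = Finset.Ico 0 n := by
    ext x; simp [Maya.mem_vac, and_comm]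
  have h2 : Set.Iio 0 \ (Maya.vac n).1 = Finset.Ico n 0 := by
    ext x; simp [Maya.mem_vac, and_comm]
  rw [Maya.charge, h1, h2, Set.ncard_coe_finset, Set.ncard_coe_finset, Int.card_Ico, Int.card_Ico]
  omega

end Currents

/-! ### The left vacua -/

section Bra

theorem bra_apply (n : ℤ) (U : Fock) : bra n U = U (Maya.vac n) := rfl

theorem bra_psi_eq_zero {n k : ℤ} (h : n ≤ k) : bra n ∘ₗ psi k = 0 := by
  classical
  refine fock_hom_ext fun S => ?_
  rw [LinearMap.comp_apply, psi_ket]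
  split_ifs
  · simp
  · rw [map_smul, bra_ket, if_neg, smul_zero]; · rfl
    intro h'
    have : k ∈ (S.insert k).1 := Or.inl rfl
    rw [h', Maya.mem_vac] at this
    omega

theorem bra_psiStar_eq_zero {n k : ℤ} (h : k < n) : bra n ∘ₗ psiStar k = 0 := by
  classical
  refine fock_hom_ext fun S => ?_
  rw [LinearMap.comp_apply, psiStar_ket]
  split_ifs
  · rw [map_smul, bra_ket, if_neg, smul_zero]; · rfl
    intro h'
    have : k ∈ (Maya.vac n).1 := h
    rw [← h', Maya.mem_erase] at this
    exact this.2 rfl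
  · simp

theorem Maya.sign_vac {n k : ℤ} (h : n ≤ k + 1) : (Maya.vac n).sign k = 1 := by
  have : (Maya.vac n).1 ∩ Set.Ioi k = ∅ := by
    ext x
    simp only [Set.mem_inter_iff, Maya.mem_vac, Set.mem_Ioi, Set.mem_empty_iff_false, iff_false]
    omega
  rw [Maya.sign, Maya.above, this, Set.ncard_empty, pow_zero]

theorem Maya.insert_vac (n : ℤ) : (Maya.vac n).insert n = Maya.vac (n + 1) := by
  ext j; simp only [Maya.mem_insert, Maya.mem_vac]; omega

theorem Maya.erase_vac (n : ℤ) : (Maya.vac (n + 1)).erase n = Maya.vac n := by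
  ext j; simp only [Maya.mem_erase, Maya.mem_vac]; omega

theorem bra_psi (n : ℤ) : bra (n + 1) ∘ₗ psi n = bra n := by
  classical
  refine fock_hom_ext fun S => ?_
  rw [LinearMap.comp_apply, psi_ket, bra_ket]
  by_cases hS : S = Maya.vac n
  · subst hS
    rw [if_neg (by simp [Maya.mem_vac]), map_smul, Maya.insert_vac, bra_ket,
      Maya.sign_vac (by omega)]
    simp
  · rw [if_neg hS]
    split_ifs with h
    · simp
    · rw [map_smul, bra_ket, if_neg, smul_zero]
      intro h'
      apply hS
      rw [← Maya.erase_insert h, h', Maya.erase_vac]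

theorem bra_psiStar (n : ℤ) : bra n ∘ₗ psiStar n = bra (n + 1) := by
  classical
  refine fock_hom_ext fun S => ?_
  rw [LinearMap.comp_apply, psiStar_ket, bra_ket]
  by_cases hS : S = Maya.vac (n + 1)
  · subst hS
    rw [if_pos (by simp [Maya.mem_vac]), map_smul, Maya.erase_vac, bra_ket,
      Maya.sign_vac (by omega)]
    simp
  · rw [if_neg hS]
    split_ifs with h
    · rw [map_smul, bra_ket, if_neg, smul_zero]
      intro h'
      apply hS
      rw [← Maya.insert_erase h, h', Maya.insert_vac]
    · simp

/-- Anticommute so that the factor killed by `⟨n|` stands on the left. In `⟨n| J_k` only the terms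
with `j < n ≤ j + k` survive, which are finitely many, and none if `k < 0`. -/
theorem bra_psi_psiStar_eq_zero {n j l : ℤ} (hjl : j ≠ l) (h : n ≤ j ∨ l < n) (U : Fock) :
    bra n (psi j (psiStar l U)) = 0 := by
  rcases h with h | h
  · exact LinearMap.congr_fun (bra_psi_eq_zero h) _
  · rw [← Module.End.mul_apply, psi_psiStar, if_neg hjl, zero_sub, LinearMap.neg_apply, map_neg,
      Module.End.mul_apply]
    have := LinearMap.congr_fun (bra_psiStar_eq_zero h) (psi j U)
    rw [LinearMap.comp_apply] at this
    rw [this]; simp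

theorem bra_J_neg (n : ℤ) {k : ℤ} (hk : k < 0) (U : Fock) : bra n (J k U) = 0 := by
  rw [map_J]
  refine finsum_eq_zero_of_forall_eq_zero fun j => ?_
  rw [normalOrdered_of_ne (by omega)]
  exact bra_psi_psiStar_eq_zero (by omega) (by omega) U

theorem bra_J_zero (n : ℤ) (U : Fock) : bra n (J 0 U) = n * bra n U := by
  rw [bra_apply, J_zero_apply, Maya.charge_vac]
  rfl

theorem bra_expP (n k : ℤ) (U : Fock) : bra n (expP k U) = bra (n - k) U := by
  classical
  have : bra n ∘ₗ expP k = bra (n - k) := by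
    refine fock_hom_ext fun S => ?_
    rw [LinearMap.comp_apply, expP_ket, bra_ket, bra_ket]
    congr 1
    rw [eq_iff_iff]
    constructor
    · intro h
      ext j
      have := Maya.mem_shift (n := k) (j := j + k) (S := S)
      rw [h, add_sub_cancel_right, Maya.mem_vac] at this
      rw [← this, Maya.mem_vac]; omega
    · rintro rfl
      ext j
      simp only [Maya.mem_shift, Maya.mem_vac]; omega
  exact LinearMap.congr_fun this U

theorem bra_chargeProj (n c : ℤ) (U : Fock) :
    bra n (chargeProj c U) = if n = c then bra n U else 0 := by
  rw [bra_apply, chargeProj_apply, Maya.charge_vac]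
  rfl

end Bra

/-! ### Exponentials of the currents -/

section ExpCurrents

/-- The coefficient of `x ^ n` in `exp (ε J_+([x]))`. -/
def expJplus (ε : ℂ) (n : ℕ) : Module.End ℂ Fock := expCoeff (ε • Jplus) n

/-- The coefficient of `x ^ n` in `exp (ε J_-([x]))`. -/
def expJminus (ε : ℂ) (n : ℕ) : Module.End ℂ Fock := expCoeff (ε • Jminus) n

theorem J_commute_of_pos {k l : ℤ} (hk : 0 < k) (hl : 0 < l) : Commute (J k) (J l) :=
  J_commute (by omega)

theorem commute_expJplus {x : Module.End ℂ Fock} (h : ∀ k : ℕ+, Commute x (J k)) (ε : ℂ) (n : ℕ) :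
    Commute x (expJplus ε n) :=
  commute_expCoeff (fun k => (h k).smul_right _) n

theorem expJplus_zero (ε : ℂ) : expJplus ε 0 = 1 := expCoeff_zero _

theorem expJminus_zero (ε : ℂ) : expJminus ε 0 = 1 := expCoeff_zero _

theorem inv_smul_smul_succ (i : ℕ) (A B : Module.End ℂ Fock) :
    ((i + 1 : ℕ) : ℂ) • (((i.succPNat : ℂ)⁻¹ • A) * B) = A * B := by
  have : ((i + 1 : ℕ) : ℂ) ≠ 0 := by exact_mod_cast i.succ_ne_zero
  rw [smul_mul_assoc, smul_smul, Nat.succPNat_coe, Nat.succ_eq_add_one, mul_inv_cancel₀ this,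
    one_smul]

/-- The factor `k` produced by `x d/dx` cancels the `1 / k` in the definition of the series. -/
theorem expJplus_rec (ε : ℂ) (m : ℕ) :
    (m : ℂ) • expJplus ε m =
      ε • ∑ i ∈ Finset.range m, J ((i + 1 : ℕ) : ℤ) * expJplus ε (m - 1 - i) := by
  have := expCoeff_rec (ε := ε) (a := fun k : ℕ+ => ((k : ℂ)⁻¹) • J k) (fun k l =>
    ((J_commute_of_pos (by positivity) (by positivity)).smul_left _).smul_right _) m
  simp only [inv_smul_smul_succ] at this
  exact this

theorem expJminus_rec (ε : ℂ) (m : ℕ) :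
    (m : ℂ) • expJminus ε m =
      ε • ∑ i ∈ Finset.range m, J (-((i + 1 : ℕ) : ℤ)) * expJminus ε (m - 1 - i) := by
  have := expCoeff_rec (ε := ε) (a := fun k : ℕ+ => ((k : ℂ)⁻¹) • J (-k)) (fun k l =>
    ((J_commute (by have := k.pos; have := l.pos; omega)).smul_left _).smul_right _) m
  simp only [inv_smul_smul_succ] at this
  exact this

theorem commutator_J_expJminus (ε : ℂ) (k : ℕ+) (m : ℕ) :
    J k * expJminus ε m - expJminus ε m * J k =
      if (k : ℕ) ≤ m then ε • expJminus ε (m - k) else 0 := by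
  refine commutator_expCoeff k (fun i => ?_) m
  rw [mul_smul_comm, smul_mul_assoc, ← smul_sub, J_mul_J]
  have hi : (k : ℤ) + -(i : ℤ) = 0 ↔ i = k := by
    rw [← PNat.coe_inj]; omega
  rw [if_congr hi rfl rfl]
  split_ifs with h
  · subst h
    have : ((i : ℕ) : ℂ) ≠ 0 := by exact_mod_cast i.pos.ne'
    rw [smul_smul, Int.cast_natCast, inv_mul_cancel₀ this, one_smul]
  · rw [smul_zero]

/-- The recursion puts some `J_{-k}` with `k > 0` leftmost, and `⟨n|` kills it. -/
theorem bra_expJminus (n : ℤ) (ε : ℂ) (m : ℕ) (U : Fock) :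
    bra n (expJminus ε m U) = if m = 0 then bra n U else 0 := by
  split_ifs with h
  · rw [h, expJminus_zero]; rfl
  · have h1 := congrArg (fun A => bra n (A U)) (expJminus_rec ε m)
    simp only [LinearMap.smul_apply, LinearMap.sum_apply, Module.End.mul_apply, map_smul,
      map_sum] at h1
    rw [Finset.sum_eq_zero fun i _ => bra_J_neg n (by omega) _, smul_zero, smul_eq_zero] at h1
    exact h1.resolve_left (by exact_mod_cast h)

theorem finsum_eq_sum_range {M : Type*} [AddCommMonoid M] (g : ℤ → M) (c : ℤ) (m : ℕ)
    (hg : ∀ p, p < c ∨ c + m ≤ p → g p = 0) :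
    ∑ᶠ p, g p = ∑ a ∈ Finset.range m, g (c + a) := by
  rw [finsum_eq_sum_of_support_subset g (s := (Finset.range m).image fun a : ℕ => c + a),
    Finset.sum_image]
  · intro a _ b _ h
    simpa using h
  · intro p hp
    have h1 : c ≤ p ∧ p < c + m := by
      by_contra h
      exact hp (hg p (by omega))
    rw [Finset.mem_coe, Finset.mem_image]
    exact ⟨(p - c).toNat, Finset.mem_range.2 (by omega), by omega⟩

theorem sum_sum_eq_zero_of_antisymm (s : Finset ℕ) (f : ℕ → ℕ → ℂ) (hf : ∀ a b, f a b = -f b a) :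
    ∑ b ∈ s, ∑ a ∈ s, f a b = 0 := by
  have h : ∑ b ∈ s, ∑ a ∈ s, f a b = -∑ b ∈ s, ∑ a ∈ s, f a b := by
    conv_lhs => rw [Finset.sum_comm]
    simp only [← Finset.sum_neg_distrib]
    exact Finset.sum_congr rfl fun a _ => Finset.sum_congr rfl fun b _ => hf a b
  exact self_eq_neg.1 h

/-- The surviving indices are `n - k, …, n - 1`. A longer window is allowed so that the double sums
below run over a square, where antisymmetry applies. -/
theorem bra_J (n : ℤ) (k : ℤ) (hk : 0 < k) (c : ℤ) (m : ℕ) (h1 : c ≤ n - k) (h2 : n ≤ c + m)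
    (U : Fock) :
    bra n (J k U) = ∑ a ∈ Finset.range m, bra n (psi (c + a) (psiStar (c + a + k) U)) := by
  rw [map_J, finsum_congr fun j => by rw [normalOrdered_of_ne (show j ≠ j + k by omega)],
    finsum_eq_sum_range _ c m]
  · rfl
  · intro p hp
    exact bra_psi_psiStar_eq_zero (by omega) (by omega) U

/-- Expanding the current and moving `ψ*` to the right gives terms `-⟨n| ψ_{n-m+a} ψ_{n-m+i}
ψ*_{n-m+a+i+1}`, where the index of `ψ*` is symmetric in `a` and `i`; so they are antisymmetric. -/
theorem sum_bra_J_psi (n : ℤ) (m : ℕ) (U : Fock) :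
    ∑ i ∈ Finset.range m, bra n (J ((i + 1 : ℕ) : ℤ) (psi (n - m + i) U)) = 0 := by
  rw [Finset.sum_congr rfl fun i hi => bra_J n ((i + 1 : ℕ) : ℤ) (by positivity) (n - m) m
    (by rw [Finset.mem_range] at hi; omega) (by omega) _]
  let f : ℕ → ℕ → ℂ := fun a i => bra n (psi (n - m + a) (psiStar (n - m + a + (i + 1 : ℕ))
    (psi (n - m + i) U)))
  refine sum_sum_eq_zero_of_antisymm _ f fun a b => ?_
  have h : ∀ a b : ℕ, f a b =
      -bra n ((psi (n - m + a) * psi (n - m + b)) (psiStar (n - m + a + b + 1) U)) := by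
    intro a b
    have e : n - m + a + (b + 1 : ℕ) = n - m + a + b + 1 := by push_cast; ring
    simp only [f, e]
    rw [← Module.End.mul_apply (psiStar _), psiStar_psi, if_neg (by omega), zero_sub]
    simp
  rw [h, h, psi_psi, show n - m + b + a + 1 = n - m + a + b + 1 by ring]
  simp

/-- The expanded terms are `⟨n| ψ_{n-m+a+b} ψ*_{n+a} ψ*_{n+b}`, antisymmetric in `a` and `b`. -/
theorem sum_bra_J_psiStar (n : ℤ) (m : ℕ) (U : Fock) :
    ∑ b ∈ Finset.range m, bra n (J (m - b) (psiStar (n + b) U)) = 0 := by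
  rw [Finset.sum_congr rfl fun (b : ℕ) hb => bra_J n (m - b) (by rw [Finset.mem_range] at hb; omega)
    (n - (m - b)) m le_rfl (by omega) _]
  let f : ℕ → ℕ → ℂ := fun a b => bra n (psi (n - (m - b) + a)
    (psiStar (n - (m - b) + a + (m - b)) (psiStar (n + b) U)))
  refine sum_sum_eq_zero_of_antisymm _ f fun a b => ?_
  have h : ∀ a b : ℕ, f a b =
      bra n (psi (n - m + a + b) ((psiStar (n + a) * psiStar (n + b)) U)) := by
    intro a b
    have e1 : n - (m - b) + a = n - m + a + b := by ring
    have e2 : n - m + a + b + (m - b) = n + a := by ring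
    simp only [f, e1, e2]
    rfl
  rw [h, h, psiStar_psiStar, show n - m + b + a = n - m + a + b by ring]
  simp

/-- Multiply by `m` and use the recursion for the exponential. By induction each of its `m` terms
becomes `⟨n| ψ J U`, and commuting `J` to the left produces the wanted matrix element once per term;
the rest sums to zero by `sum_bra_J_psi`. -/
theorem bra_psi_eq (n : ℤ) (m : ℕ) (U : Fock) :
    bra n (psi (n - 1 - m) U) = bra (n - 1) (expJplus (-1) m U) := by
  induction m using Nat.strong_induction_on generalizing U with
  | _ m ih =>
    rcases m.eq_zero_or_pos with rfl | hm
    · have := LinearMap.congr_fun (bra_psi (n - 1)) U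
      rw [sub_add_cancel] at this
      rw [expJplus_zero, Nat.cast_zero, sub_zero]
      exact this
    have hm' : (m : ℂ) ≠ 0 := by exact_mod_cast hm.ne'
    apply mul_left_cancel₀ hm'
    have h1 := congrArg (fun A => bra (n - 1) (A U)) (expJplus_rec (-1) m)
    simp only [LinearMap.smul_apply, LinearMap.sum_apply, map_smul, map_sum, smul_eq_mul] at h1
    rw [h1]
    have h2 : ∀ i ∈ Finset.range m,
        bra (n - 1) ((J ((i + 1 : ℕ) : ℤ) * expJplus (-1) (m - 1 - i)) U) =
          bra n (J ((i + 1 : ℕ) : ℤ) (psi (n - m + i) U)) - bra n (psi (n - 1 - m) U) := by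
      intro i hi
      rw [Finset.mem_range] at hi
      rw [(commute_expJplus (fun k => J_commute_of_pos (by positivity) (by positivity)) _ _).eq,
        Module.End.mul_apply, ← ih _ (by omega), eq_sub_iff_add_eq, ← map_add,
        ← Module.End.mul_apply (J _), J_mul_psi,
        show n - 1 - ((m - 1 - i : ℕ) : ℤ) = n - m + i by omega,
        show n - m + i - ((i + 1 : ℕ) : ℤ) = n - 1 - m by push_cast; ring]
      rfl
    rw [Finset.sum_congr rfl h2, Finset.sum_sub_distrib, sum_bra_J_psi, Finset.sum_const,
      Finset.card_range]
    simp

theorem bra_psiStar_eq (n : ℤ) (m : ℕ) (U : Fock) :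
    bra n (psiStar (n + m) U) = bra (n + 1) (expJplus 1 m U) := by
  induction m using Nat.strong_induction_on generalizing U with
  | _ m ih =>
    rcases m.eq_zero_or_pos with rfl | hm
    · have := LinearMap.congr_fun (bra_psiStar n) U
      rw [expJplus_zero, Nat.cast_zero, add_zero]
      exact this
    have hm' : (m : ℂ) ≠ 0 := by exact_mod_cast hm.ne'
    apply mul_left_cancel₀ hm'
    have h1 := congrArg (fun A => bra (n + 1) (A U)) (expJplus_rec 1 m)
    simp only [LinearMap.smul_apply, LinearMap.sum_apply, map_smul, map_sum, smul_eq_mul,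
      one_mul] at h1
    -- Reversal makes the index of `ψ*` increase with the summation variable, as in
    -- `sum_bra_J_psiStar`.
    rw [h1, ← Finset.sum_range_reflect]
    have h2 : ∀ b ∈ Finset.range m,
        bra (n + 1) ((J ((m - 1 - b + 1 : ℕ) : ℤ) * expJplus 1 (m - 1 - (m - 1 - b))) U) =
          bra n (J (m - b) (psiStar (n + b) U)) + bra n (psiStar (n + m) U) := by
      intro b hb
      rw [Finset.mem_range] at hb
      rw [(commute_expJplus (fun k => J_commute_of_pos (by positivity) (by positivity)) _ _).eq,
        Module.End.mul_apply, ← ih _ (by omega), show m - 1 - (m - 1 - b) = b by omega,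
        show ((m - 1 - b + 1 : ℕ) : ℤ) = m - b by omega, ← sub_eq_iff_eq_add, ← map_sub,
        ← Module.End.mul_apply (J _), J_mul_psiStar, show n + b + ((m : ℤ) - b) = n + m by ring]
      rfl
    rw [Finset.sum_congr rfl h2, Finset.sum_add_distrib, sum_bra_J_psiStar, Finset.sum_const,
      Finset.card_range]
    simp

theorem smul_Jplus_one : (1 : ℂ) • Jplus = Jplus := one_smul ℂ Jplus

theorem smul_Jplus_neg_one : (-1 : ℂ) • Jplus = -Jplus := by
  ext; simp

theorem smul_Jminus_one : (1 : ℂ) • Jminus = Jminus := one_smul ℂ Jminus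

theorem smul_Jminus_neg_one : (-1 : ℂ) • Jminus = -Jminus := by
  ext; simp

theorem bra_psiField (n m : ℤ) (U : Fock) :
    bra n (psiField U m) = bra (n - 1) (atZInv (formalExp (-Jplus)) (m - (n - 1)) U) := by
  -- For `m ≥ n` both sides vanish: the left by `⟨n| ψ_m = 0`, the right because only nonpositive
  -- powers of `z` occur in the exponential.
  rw [← smul_Jplus_neg_one, psiField, atZInv]
  rcases lt_or_ge m n with h | h
  · obtain ⟨j, hj⟩ : ∃ j : ℕ, (j : ℤ) = -(m - (n - 1)) := ⟨(n - 1 - m).toNat, by omega⟩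
    rw [← hj, atZ_formalExp_natCast, show m = n - 1 - j by omega]
    exact bra_psi_eq n j U
  · rw [atZ_of_neg _ (by omega)]
    have := LinearMap.congr_fun (bra_psi_eq_zero h) U
    simpa using this

theorem bra_psiStarField (n m : ℤ) (U : Fock) :
    bra n (psiStarField U m) = bra (n + 1) (atZInv (formalExp Jplus) (m + n) U) := by
  rw [← smul_Jplus_one, psiStarField, atZInv]
  rcases lt_or_ge (-m) n with h | h
  · rw [atZ_of_neg _ (by omega)]
    have := LinearMap.congr_fun (bra_psiStar_eq_zero h) U
    simpa using this
  · obtain ⟨j, hj⟩ : ∃ j : ℕ, (j : ℤ) = -(m + n) := ⟨(-(m + n)).toNat, by omega⟩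
    rw [← hj, atZ_formalExp_natCast, show -m = n + j by omega]
    exact bra_psiStar_eq n j U

end ExpCurrents

/-! ### Energy -/

section Energy

open Classical

/-- The contribution of the site `s` to the energy. -/
def Maya.energyAt (S : Maya) (s : ℤ) : ℤ := if s ∈ S.1 then max s 0 else max (-s) 0

/-- The energy of a state: the sum of its positive elements and of the absolute values of the
negative integers it lacks. -/
def Maya.energy (S : Maya) : ℤ := ∑ᶠ s, S.energyAt s

theorem Maya.energyAt_nonneg (S : Maya) (s : ℤ) : 0 ≤ S.energyAt s := by
  unfold Maya.energyAt
  split_ifs <;> exact le_max_right _ _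

theorem Maya.energy_nonneg (S : Maya) : 0 ≤ S.energy := finsum_nonneg S.energyAt_nonneg

theorem Maya.energyAt_support_finite (S : Maya) : (Function.support S.energyAt).Finite := by
  obtain ⟨a, b, ha, hb⟩ := S.2
  refine (Set.finite_Icc (min a 0) (max b 0)).subset fun s hs => ?_
  have h1 : s < a → s ∈ S.1 := fun h => ha h
  have h2 : s ∈ S.1 → s < b := fun h => hb h
  rw [Set.mem_Icc]
  by_contra h
  apply hs
  unfold Maya.energyAt
  split_ifs with h3
  · have := h2 h3; omega
  · have : ¬ s < a := fun h => h3 (h1 h)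
    omega

/-- A particle at `k ≥ 0` adds `k`; filling a hole at `k < 0` removes its contribution `-k`. So both
cases change the energy by `k`. -/
theorem Maya.energy_insert {k : ℤ} {S : Maya} (h : k ∉ S.1) :
    (S.insert k).energy = S.energy + k := by
  have h1 : ∀ s, (S.insert k).energyAt s = S.energyAt s + if s + 0 = k then s else 0 := by
    intro s
    unfold Maya.energyAt
    rw [add_zero]
    by_cases hs : s = k
    · subst hs
      rw [if_pos (show s ∈ (S.insert s).1 from Or.inl rfl), if_neg h, if_pos rfl]; omega
    · simp [Maya.mem_insert, hs]
  rw [Maya.energy, finsum_congr h1, finsum_add_distrib S.energyAt_support_finite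
    (ite_support_finite k 0 _), finsum_ite k 0 fun s => s, sub_zero, Maya.energy]

theorem Maya.energy_erase {k : ℤ} {S : Maya} (h : k ∈ S.1) :
    (S.erase k).energy = S.energy - k := by
  have := Maya.energy_insert (S := S.erase k) (k := k) fun h' => h'.2 rfl
  rw [Maya.insert_erase h] at this
  omega

/-- The span of the states of energy at most `N`. -/
def energyLE (N : ℤ) : Submodule ℂ Fock := Finsupp.supported ℂ ℂ {S | S.energy ≤ N}

theorem ket_mem_energyLE {S : Maya} {N : ℤ} (h : S.energy ≤ N) : ket S ∈ energyLE N :=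
  Finsupp.single_mem_supported ℂ 1 h

theorem map_mem_energyLE {T : Module.End ℂ Fock} {N M : ℤ}
    (h : ∀ S : Maya, S.energy ≤ N → T (ket S) ∈ energyLE M) {U : Fock} (hU : U ∈ energyLE N) :
    T U ∈ energyLE M := by
  have : energyLE N ≤ (energyLE M).comap T := by
    rw [energyLE, Finsupp.supported_eq_span_single, Submodule.span_le]
    rintro _ ⟨S, hS, rfl⟩
    exact h S hS
  exact this hU

theorem psi_mem_energyLE (k : ℤ) {N : ℤ} {U : Fock} (hU : U ∈ energyLE N) :
    psi k U ∈ energyLE (N + k) := by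
  refine map_mem_energyLE (fun S hS => ?_) hU
  rw [psi_ket]
  split_ifs with h
  · exact zero_mem _
  · exact Submodule.smul_mem _ _ (ket_mem_energyLE (by rw [Maya.energy_insert h]; omega))

theorem psiStar_mem_energyLE (k : ℤ) {N : ℤ} {U : Fock} (hU : U ∈ energyLE N) :
    psiStar k U ∈ energyLE (N - k) := by
  refine map_mem_energyLE (fun S hS => ?_) hU
  rw [psiStar_ket]
  split_ifs with h
  · exact Submodule.smul_mem _ _ (ket_mem_energyLE (by rw [Maya.energy_erase h]; omega))
  · exact zero_mem _

theorem J_mem_energyLE {k : ℤ} (hk : k ≠ 0) {N : ℤ} {U : Fock} (hU : U ∈ energyLE N) :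
    J k U ∈ energyLE (N - k) := by
  rw [J_apply_of_ne_zero hk]
  refine finsum_induction (· ∈ energyLE (N - k)) (zero_mem _) (fun _ _ => add_mem) fun j => ?_
  have := psi_mem_energyLE j (psiStar_mem_energyLE (j + k) hU)
  rwa [show N - (j + k) + j = N - k by ring] at this

theorem eq_zero_of_mem_energyLE {N : ℤ} (hN : N < 0) {U : Fock} (hU : U ∈ energyLE N) : U = 0 := by
  rw [energyLE, Finsupp.mem_supported] at hU
  rw [← Finsupp.support_eq_empty, Finset.eq_empty_iff_forall_notMem]
  intro S hS
  have h1 : S.energy ≤ N := hU hS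
  have h2 := S.energy_nonneg
  omega

theorem energyLE_mono {N M : ℤ} (h : N ≤ M) : energyLE N ≤ energyLE M :=
  Finsupp.supported_mono fun _ hS => le_trans hS h

theorem exists_mem_energyLE (U : Fock) : ∃ N, U ∈ energyLE N := by
  induction U using Finsupp.induction_linear with
  | zero => exact ⟨0, zero_mem _⟩
  | add U V hU hV =>
    obtain ⟨N, hN⟩ := hU
    obtain ⟨M, hM⟩ := hV
    exact ⟨max N M, add_mem (energyLE_mono (le_max_left _ _) hN)
      (energyLE_mono (le_max_right _ _) hM)⟩
  | single S c => exact ⟨S.energy, Finsupp.single_mem_supported ℂ c (le_refl S.energy)⟩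

theorem expJplus_mem_energyLE (ε : ℂ) (m : ℕ) {N : ℤ} {U : Fock} (hU : U ∈ energyLE N) :
    expJplus ε m U ∈ energyLE (N - m) := by
  induction m using Nat.strong_induction_on with
  | _ m ih =>
    rcases m.eq_zero_or_pos with rfl | hm
    · rw [expJplus_zero]; simpa using hU
    have hm' : (m : ℂ) ≠ 0 := by exact_mod_cast hm.ne'
    rw [← Submodule.smul_mem_iff _ hm', ← LinearMap.smul_apply, expJplus_rec,
      LinearMap.smul_apply, LinearMap.sum_apply]
    refine Submodule.smul_mem _ _ (Submodule.sum_mem _ fun i hi => ?_)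
    rw [Finset.mem_range] at hi
    have := J_mem_energyLE (k := ((i + 1 : ℕ) : ℤ)) (by omega) (ih (m - 1 - i) (by omega))
    rwa [show N - ((m - 1 - i : ℕ) : ℤ) - ((i + 1 : ℕ) : ℤ) = N - m by omega] at this

/-- The `m`-th coefficient lowers the energy by `m`, and no nonzero vector has negative energy. -/
theorem locallyFinite_expJplus (ε : ℂ) : LocallyFinite (atZInv (formalExp (ε • Jplus))) := by
  intro U
  obtain ⟨N, hN⟩ := exists_mem_energyLE U
  refine (Set.finite_Icc (-N) 0).subset fun m hm => ?_
  have h0 : m ≤ 0 := by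
    by_contra h
    apply hm
    simp [atZInv, atZ_of_neg _ (show -m < 0 by omega)]
  refine ⟨?_, h0⟩
  by_contra h
  apply hm
  obtain ⟨j, hj⟩ : ∃ j : ℕ, (j : ℤ) = -m := ⟨(-m).toNat, by omega⟩
  simp only [atZInv, ← hj, atZ_formalExp_natCast]
  exact eq_zero_of_mem_energyLE (by omega) (expJplus_mem_energyLE ε j hN)

end Energy

/-! ### The exponential of `J_+(t)` -/

section ExpTimes

/-- The coefficient of `t ^ d` in `exp (J_+(t))`. -/
def expTimes (d : ℕ+ →₀ ℕ) : Module.End ℂ Fock := MvPowerSeries.coeff d (formalExp JplusTimes)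

theorem coeff_amplitude (l : ℤ) (d : ℕ+ →₀ ℕ) (U : Fock) :
    MvPowerSeries.coeff d (amplitude l U) = bra l (expTimes d U) := rfl

theorem coeff_single_JplusTimes (k : ℕ+) :
    MvPowerSeries.coeff (Finsupp.single k 1) JplusTimes = J k := by
  classical
  change ∑ j ∈ (Finsupp.single k 1).support,
    (if Finsupp.single k 1 = Finsupp.single j 1 then J j else 0) = J k
  rw [Finset.sum_eq_single k, if_pos rfl]
  · exact fun j _ hj => if_neg fun h => hj ((Finsupp.single_left_inj one_ne_zero).1 h).symm
  · exact fun h => absurd (by simp) h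

theorem coeff_JplusTimes_of_ne {d : ℕ+ →₀ ℕ} (h : ∀ k, d ≠ Finsupp.single k 1) :
    MvPowerSeries.coeff d JplusTimes = 0 := by
  classical
  change ∑ j ∈ d.support, (if d = Finsupp.single j 1 then J j else 0) = 0
  exact Finset.sum_eq_zero fun j _ => if_neg (h j)

theorem forall_coeff_JplusTimes {p : Module.End ℂ Fock → Prop} (h0 : p 0)
    (h : ∀ k : ℕ+, p (J k)) (d : ℕ+ →₀ ℕ) : p (MvPowerSeries.coeff d JplusTimes) := by
  by_cases hd : ∃ k, d = Finsupp.single k 1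
  · obtain ⟨k, rfl⟩ := hd
    rw [coeff_single_JplusTimes]
    exact h k
  · rwa [coeff_JplusTimes_of_ne fun k hk => hd ⟨k, hk⟩]

/-- Covers the two derivations used on `J_+(t)`, namely `t_k ∂/∂t_k` and `[J_{-k}, ·]`; each leaves
only the monomial `t_k`. -/
theorem coeffwise_JplusTimes {δ : (ℕ+ →₀ ℕ) → Module.End ℂ Fock →ₗ[ℂ] Module.End ℂ Fock} {k : ℕ+}
    {A : Module.End ℂ Fock} (hk : δ (Finsupp.single k 1) (J k) = A)
    (h : ∀ j : ℕ+, j ≠ k → δ (Finsupp.single j 1) (J j) = 0) :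
    coeffwise δ JplusTimes = MvPowerSeries.monomial (Finsupp.single k 1) A := by
  classical
  ext1 d
  rw [coeff_coeffwise, MvPowerSeries.coeff_monomial]
  by_cases hd : ∃ j, d = Finsupp.single j 1
  · obtain ⟨j, rfl⟩ := hd
    rw [coeff_single_JplusTimes, if_congr (Finsupp.single_left_inj one_ne_zero) rfl rfl]
    split_ifs with hj
    · rw [hj, hk]
    · exact h j hj
  · rw [coeff_JplusTimes_of_ne fun j hj => hd ⟨j, hj⟩, map_zero, if_neg fun h => hd ⟨k, h⟩]

theorem constantCoeff_JplusTimes : MvPowerSeries.constantCoeff JplusTimes = 0 := by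
  rw [← MvPowerSeries.coeff_zero_eq_constantCoeff_apply]
  refine coeff_JplusTimes_of_ne fun k h => ?_
  have := DFunLike.congr_fun h k
  simp at this

theorem expTimes_zero : expTimes 0 = 1 := coeff_zero_formalExp _

theorem commute_expTimes {x : Module.End ℂ Fock} (h : ∀ k : ℕ+, Commute x (J k)) (d : ℕ+ →₀ ℕ) :
    Commute x (expTimes d) :=
  commute_coeff_formalExp (forall_coeff_JplusTimes (Commute.zero_right x) h) d

theorem commute_J_expTimes (k : ℕ+) (d : ℕ+ →₀ ℕ) : Commute (J k) (expTimes d) :=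
  commute_expTimes (fun _ => J_commute_of_pos (by positivity) (by positivity)) d

/-- The coefficient of `t^d` in `∂/∂t_k exp J_+(t) = J_k exp J_+(t)`, read off from the Euler
operator `t_k ∂/∂t_k` one degree higher. -/
theorem expTimes_rec (k : ℕ+) (d : ℕ+ →₀ ℕ) :
    ((d k + 1 : ℕ) : ℂ) • expTimes (d + Finsupp.single k 1) = J k * expTimes d := by
  classical
  have e0 : coeffwise (euler (Finsupp.applyAddHom k)) JplusTimes =
      MvPowerSeries.monomial (Finsupp.single k 1) (J k) :=
    coeffwise_JplusTimes (by simp [euler]) fun j hj => by simp [euler, hj]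
  have hc : Commute (coeffwise (euler (Finsupp.applyAddHom k)) JplusTimes) JplusTimes := by
    refine commute_of_coeff fun d e => ?_
    rw [coeff_coeffwise, euler, LinearMap.smul_apply, LinearMap.id_apply]
    refine Commute.smul_left (forall_coeff_JplusTimes (p := fun a => Commute a _)
      (Commute.zero_left _) (fun j => ?_) d) _
    refine forall_coeff_JplusTimes (Commute.zero_right _) (fun i => ?_) e
    exact J_commute_of_pos (by positivity) (by positivity)
  have key := congrArg (MvPowerSeries.coeff (Finsupp.single k 1 + d))
    ((isLeibniz_euler _).map_formalExp constantCoeff_JplusTimes hc)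
  rw [e0, MvPowerSeries.coeff_add_monomial_mul, add_comm (Finsupp.single k 1)] at key
  refine Eq.trans ?_ key
  rw [coeff_coeffwise, euler]
  simp [expTimes]

/-- By the Heisenberg relations `[J_{-k}, J_+(t)] = -k t_k`, which is central. -/
theorem J_neg_mul_expTimes (k : ℕ+) (d : ℕ+ →₀ ℕ) :
    J (-k) * expTimes d - expTimes d * J (-k) =
      if Finsupp.single k 1 ≤ d then (-(k : ℂ)) • expTimes (d - Finsupp.single k 1) else 0 := by
  classical
  have e0 : coeffwise (ad (J (-k))) JplusTimes =
      MvPowerSeries.monomial (Finsupp.single k 1) (-(k : ℂ) • (1 : Module.End ℂ Fock)) := by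
    refine coeffwise_JplusTimes ?_ fun j hj => ?_
    · change J (-k) * J k - J k * J (-k) = _
      rw [J_mul_J, if_pos (by ring)]
      simp
    · change J (-k) * J j - J j * J (-k) = _
      rw [J_mul_J, if_neg]
      rw [← PNat.coe_inj.ne] at hj
      omega
  have hc : Commute (coeffwise (ad (J (-k))) JplusTimes) JplusTimes := by
    rw [e0]
    refine commute_of_coeff fun d e => ?_
    rw [MvPowerSeries.coeff_monomial]
    split_ifs
    · exact (Commute.one_left _).smul_left _
    · exact Commute.zero_left _
  have key := congrArg (MvPowerSeries.coeff d)
    ((isLeibniz_ad _).map_formalExp constantCoeff_JplusTimes hc)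
  rw [e0, MvPowerSeries.coeff_monomial_mul] at key
  refine Eq.trans (Eq.trans rfl key) ?_
  split_ifs
  · rw [smul_mul_assoc, one_mul]; rfl
  · rfl

theorem single_add_induction {p : (ℕ+ →₀ ℕ) → Prop} (h0 : p 0)
    (h : ∀ d k, p d → p (d + Finsupp.single k 1)) (d : ℕ+ →₀ ℕ) : p d := by
  induction d using Finsupp.induction₂ with
  | zero => exact h0
  | add_single k b d _ _ hd =>
    clear * - h hd
    induction b with
    | zero => simpa using hd
    | succ b ih => rw [Finsupp.single_add, ← add_assoc]; exact h _ _ ih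

/-- The weight `∑ k d_k` of the monomial `t ^ d`. -/
def timesWeight : (ℕ+ →₀ ℕ) →+ ℕ := Finsupp.weight fun k : ℕ+ => (k : ℕ)

theorem timesWeight_single (k : ℕ+) : timesWeight (Finsupp.single k 1) = k := by
  simp [timesWeight, Finsupp.weight_single]

theorem expTimes_mem_energyLE (d : ℕ+ →₀ ℕ) {N : ℤ} {U : Fock} (hU : U ∈ energyLE N) :
    expTimes d U ∈ energyLE (N - timesWeight d) := by
  induction d using single_add_induction with
  | h0 => rw [expTimes_zero]; simpa using hU
  | h d k ih =>
    have hd : ((d k + 1 : ℕ) : ℂ) ≠ 0 := by exact_mod_cast (d k).succ_ne_zero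
    rw [← Submodule.smul_mem_iff _ hd, ← LinearMap.smul_apply, expTimes_rec, map_add,
      timesWeight_single]
    have := J_mem_energyLE (k := k) (by have := k.pos; omega) ih
    rwa [show N - timesWeight d - (k : ℕ) = N - (timesWeight d + k : ℕ) by push_cast; ring] at this

theorem timesWeight_le_finite (M : ℕ) : {d | timesWeight d ≤ M}.Finite := by
  classical
  -- Weight at most `M` forces the support into `{1, …, M}` and every exponent to be at most `M`.
  refine (Set.finite_Iic (Finsupp.indicator ((Finset.range M).image Nat.succPNat)
    fun _ _ => M)).subset fun d hd k => ?_
  have hw : timesWeight d ≤ M := hd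
  by_cases hk : d k = 0
  · rw [hk]; exact Nat.zero_le _
  have h1 : (k : ℕ) ≤ timesWeight d :=
    Finsupp.le_weight_of_ne_zero' (fun k : ℕ+ => (k : ℕ)) hk
  have h2 : d k ≤ timesWeight d := Finsupp.le_weight (fun k : ℕ+ => (k : ℕ)) k.pos.ne' d
  rw [Finsupp.indicator_of_mem]
  · omega
  · rw [Finset.mem_image]
    exact ⟨k.natPred, by rw [Finset.mem_range, PNat.natPred]; have := k.pos; omega,
      k.succPNat_natPred⟩

theorem Maya.vac_injective : Function.Injective Maya.vac := fun m n h => by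
  rw [← Maya.charge_vac m, h, Maya.charge_vac]

/-- The energy of `U` bounds the weight of `d`, leaving finitely many `d`; for each of them the
vector has finite support, leaving finitely many `l`. -/
theorem amplitude_support_finite (U : Fock) :
    {p : ℤ × (ℕ+ →₀ ℕ) | bra p.1 (expTimes p.2 U) ≠ 0}.Finite := by
  obtain ⟨N, hN⟩ := exists_mem_energyLE U
  have hfin : ∀ d, {l | bra l (expTimes d U) ≠ 0}.Finite := fun d =>
    ((expTimes d U).hasFiniteSupport.preimage Maya.vac_injective.injOn :)
  refine ((timesWeight_le_finite N.toNat).biUnion fun d _ =>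
    (hfin d).image fun l => (l, d)).subset ?_
  rintro ⟨l, d⟩ hp
  refine Set.mem_biUnion (x := d) ?_ ⟨l, hp, rfl⟩
  by_contra h
  rw [Set.mem_ofPred_eq, not_le] at h
  apply hp
  simp only
  rw [eq_zero_of_mem_energyLE (by omega) (expTimes_mem_energyLE d hN), map_zero]

end ExpTimes

/-! ### The boson-fermion correspondence -/

section BosonFock

theorem bosonFock_ext {f g : BosonFock}
    (h : ∀ l d, MvPolynomial.coeff d (f.coeff l) = MvPolynomial.coeff d (g.coeff l)) : f = g :=
  LaurentPolynomial.ext fun l => MvPolynomial.ext _ _ fun d => h l d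

theorem coeff_Phi (U : Fock) (l : ℤ) (d : ℕ+ →₀ ℕ) :
    MvPolynomial.coeff d ((Phi U).coeff l) = bra l (expTimes d U) := by
  classical
  let g : BosonFock →+ ℂ := AddMonoidHom.mk' (fun f => MvPolynomial.coeff d (f.coeff l))
    fun f g => by simp
  change g (Phi U) = _
  rw [Phi, AddMonoidHom.map_finsum]
  · rw [finsum_eq_single _ (l, d)]
    · change MvPolynomial.coeff d ((LaurentPolynomial.C _ * LaurentPolynomial.T l).coeff l) = _
      rw [← LaurentPolynomial.single_eq_C_mul_T, AddMonoidAlgebra.coeff_single, Finsupp.single_apply, if_pos rfl,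
        MvPolynomial.coeff_monomial, if_pos rfl]
      rfl
    · rintro ⟨l', d'⟩ hne
      change MvPolynomial.coeff d ((LaurentPolynomial.C _ * LaurentPolynomial.T l').coeff l) = _
      rw [← LaurentPolynomial.single_eq_C_mul_T, AddMonoidAlgebra.coeff_single, Finsupp.single_apply]
      split_ifs with h
      · rw [MvPolynomial.coeff_monomial, if_neg]
        rintro rfl
        exact hne (by rw [h])
      · rfl
  · refine (amplitude_support_finite U).subset fun p hp h => hp ?_
    simp only
    rw [coeff_amplitude, h]
    simp

theorem coe_coeff_Phi (U : Fock) (l : ℤ) :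
    (((Phi U).coeff l : MvPolynomial ℕ+ ℂ) : MvPowerSeries ℕ+ ℂ) = amplitude l U := by
  ext d
  rw [MvPolynomial.coeff_coe, coeff_Phi, coeff_amplitude]

/-- `Φ` as a linear map. -/
def PhiHom : Fock →ₗ[ℂ] BosonFock where
  toFun := Phi
  map_add' U V := bosonFock_ext fun l d => by simp [coeff_Phi]
  map_smul' c U := bosonFock_ext fun l d => by simp [coeff_Phi]

theorem PhiHom_apply (U : Fock) : PhiHom U = Phi U := rfl

theorem coeff_dTime (k : ℕ+) (f : BosonFock) (l : ℤ) :
    (dTime k f).coeff l = MvPolynomial.pderiv k (f.coeff l) := rfl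

theorem coeff_time_mul (k : ℕ+) (f : BosonFock) (l : ℤ) :
    (time k * f).coeff l = MvPolynomial.X k * f.coeff l :=
  AddMonoidAlgebra.coeff_single_zero_mul _ _ _

theorem coeff_T_mul (n : ℤ) (f : BosonFock) (l : ℤ) :
    (LaurentPolynomial.T n * f).coeff l = f.coeff (l - n) := by
  have := AddMonoidAlgebra.coeff_single_mul_add f (1 : MvPolynomial ℕ+ ℂ) n (l - n)
  rw [add_sub_cancel, one_mul] at this
  exact this

theorem coeff_wProj (c : ℤ) (f : BosonFock) (l : ℤ) :
    (wProj c f).coeff l = if l = c then f.coeff l else 0 := by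
  change (LaurentPolynomial.C (f.coeff c) * LaurentPolynomial.T c).coeff l = _
  rw [← LaurentPolynomial.single_eq_C_mul_T, AddMonoidAlgebra.coeff_single, Finsupp.single_apply]
  by_cases h : l = c
  · simp [h]
  · simp [h, Ne.symm h]

theorem coeff_wdw (f : BosonFock) (l : ℤ) : (wdw f).coeff l = (l : ℂ) • f.coeff l := by
  rw [wdw, AddMonoidAlgebra.coeff_finsuppSum, Finsupp.sum_apply, Finsupp.sum_eq_single l]
  · rw [← LaurentPolynomial.single_eq_C_mul_T, AddMonoidAlgebra.coeff_smul_apply,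
      AddMonoidAlgebra.coeff_single, Finsupp.single_apply, if_pos rfl]
  · intro j _ hj
    rw [← LaurentPolynomial.single_eq_C_mul_T, AddMonoidAlgebra.coeff_smul_apply,
      AddMonoidAlgebra.coeff_single, Finsupp.single_apply, if_neg hj, smul_zero]
  · intro _
    simp

end BosonFock

/-! ### Currents, shifts and charge under `Φ`; injectivity of `Φ` -/

section Correspondence

theorem Phi_J_pos (k : ℕ+) (U : Fock) : Phi (J k U) = dTime k (Phi U) := by
  refine bosonFock_ext fun l d => ?_
  rw [coeff_Phi, coeff_dTime, MvPolynomial.coeff_pderiv, coeff_Phi, ← Module.End.mul_apply,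
    ← (commute_J_expTimes k d).eq, ← expTimes_rec]
  simp [mul_comm]

theorem Phi_J_zero (U : Fock) : Phi (J 0 U) = wdw (Phi U) := by
  refine bosonFock_ext fun l d => ?_
  have h : Commute (J 0) (expTimes d) :=
    commute_expTimes (fun k => J_commute (by have := k.pos; omega)) d
  rw [coeff_Phi, coeff_wdw, MvPolynomial.coeff_smul, coeff_Phi, ← Module.End.mul_apply, ← h.eq,
    Module.End.mul_apply, bra_J_zero]
  rfl

/-- Moving `J_{-k}` to the left through the exponential leaves only the commutator, since `⟨l|
J_{-k} = 0`. -/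
theorem Phi_J_neg (k : ℕ+) (U : Fock) : Phi (J (-k) U) = (k : ℂ) • (time k * Phi U) := by
  classical
  refine bosonFock_ext fun l d => ?_
  have h := congrArg (fun A => bra l (A U)) (J_neg_mul_expTimes k d)
  simp only [LinearMap.sub_apply, Module.End.mul_apply, map_sub] at h
  rw [bra_J_neg l (by have := k.pos; omega), zero_sub, neg_eq_iff_eq_neg] at h
  rw [coeff_Phi, AddMonoidAlgebra.coeff_smul_apply, coeff_time_mul, MvPolynomial.coeff_smul,
    MvPolynomial.coeff_X_mul', coeff_Phi, h]
  have hk : Finsupp.single k 1 ≤ d ↔ k ∈ d.support := by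
    rw [Finsupp.single_le_iff, Finsupp.mem_support_iff, Nat.one_le_iff_ne_zero]
  rw [if_congr hk rfl rfl]
  split_ifs <;> simp

theorem Phi_expP (n : ℤ) (U : Fock) : Phi (expP n U) = bExpP n (Phi U) := by
  refine bosonFock_ext fun l d => ?_
  have h : Commute (expP n) (expTimes d) :=
    commute_expTimes (fun k => (J_commute_expP (by have := k.pos; omega) n).symm) d
  change _ = MvPolynomial.coeff d ((LaurentPolynomial.T n * Phi U).coeff l)
  rw [coeff_T_mul, coeff_Phi, coeff_Phi, ← Module.End.mul_apply, ← h.eq, Module.End.mul_apply,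
    bra_expP]

theorem Phi_chargeProj (c : ℤ) (U : Fock) : Phi (chargeProj c U) = wProj c (Phi U) := by
  refine bosonFock_ext fun l d => ?_
  have h : Commute (chargeProj c) (expTimes d) :=
    commute_expTimes (fun k => (J_commute_chargeProj k c).symm) d
  rw [coeff_wProj, coeff_Phi, ← Module.End.mul_apply, ← h.eq, Module.End.mul_apply,
    bra_chargeProj]
  split_ifs
  · rw [coeff_Phi]
  · rfl

/-- If `[J_k, T(z)] = ε z ^ k T(z)` for `k > 0` and all `⟨n| T(z)` vanish on a subset of `H_F` that
is stable under these `J_k`, then so does `Φ T(z)`. -/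
theorem Phi_eq_zero_of_bra_eq_zero {K : Set Fock} (hK : ∀ V ∈ K, ∀ k : ℕ+, J k V ∈ K)
    {T : ℤ → Fock → Fock} {ε : ℂ}
    (hT : ∀ (k : ℕ+) m V, J k (T m V) = T m (J k V) + ε • T (m - k) V)
    (h0 : ∀ n m, ∀ V ∈ K, bra n (T m V) = 0) {V : Fock} (hV : V ∈ K) (m : ℤ) :
    Phi (T m V) = 0 := by
  suffices h : ∀ d l m, ∀ V ∈ K, bra l (expTimes d (T m V)) = 0 from
    bosonFock_ext fun l d => by rw [coeff_Phi, h d l m V hV]; rfl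
  intro d
  induction d using single_add_induction with
  | h0 =>
    intro l m V hV
    rw [expTimes_zero]
    exact h0 l m V hV
  | h d k ih =>
    intro l m V hV
    have hd : ((d k + 1 : ℕ) : ℂ) ≠ 0 := by exact_mod_cast (d k).succ_ne_zero
    -- Moving `J_k` past the coefficient at `d` and then past `T` leaves `T m (J k V)` and `T (m -
    -- k) V`, both covered by the induction hypothesis because `K` is stable under `J k`.
    have h1 := congrArg (fun A => bra l (A (T m V))) (expTimes_rec k d)
    simp only [(commute_J_expTimes k d).eq, Module.End.mul_apply, LinearMap.smul_apply, map_smul,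
      hT, map_add, ih l m _ (hK V hV k), ih l (m - k) V hV, smul_zero, add_zero,
      smul_eq_zero] at h1
    exact h1.resolve_left hd

theorem bra_expJplus_eq_zero {K : Set Fock} (hK : ∀ V ∈ K, ∀ k : ℕ+, J k V ∈ K)
    (h0 : ∀ n, ∀ V ∈ K, bra n V = 0) (n : ℤ) (ε : ℂ) (m : ℕ) {V : Fock} (hV : V ∈ K) :
    bra n (expJplus ε m V) = 0 := by
  induction m using Nat.strong_induction_on generalizing V with
  | _ m ih =>
    rcases m.eq_zero_or_pos with rfl | hm
    · rw [expJplus_zero]; exact h0 n V hV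
    have hm' : (m : ℂ) ≠ 0 := by exact_mod_cast hm.ne'
    have h1 := congrArg (fun A => bra n (A V)) (expJplus_rec ε m)
    simp only [LinearMap.smul_apply, LinearMap.sum_apply, map_smul, map_sum] at h1
    rw [Finset.sum_eq_zero, smul_zero, smul_eq_zero] at h1
    · exact h1.resolve_left hm'
    · intro i hi
      rw [Finset.mem_range] at hi
      rw [(commute_expJplus (fun k => J_commute_of_pos (by positivity) (by positivity)) _ _).eq]
      exact ih _ (by omega) (hK V hV i.succPNat)

theorem J_psiField (k : ℤ) (m : ℤ) (U : Fock) :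
    J k (psiField U m) = psiField (J k U) m + (1 : ℂ) • psiField U (m - k) := by
  have := LinearMap.congr_fun (J_mul_psi k m) U
  rw [one_smul]
  exact this

theorem J_psiStarField (k : ℤ) (m : ℤ) (U : Fock) :
    J k (psiStarField U m) = psiStarField (J k U) m + (-1 : ℂ) • psiStarField U (m - k) := by
  have := LinearMap.congr_fun (J_mul_psiStar k (-m)) U
  rw [neg_smul, one_smul, ← sub_eq_add_neg, psiStarField, psiStarField, psiStarField, neg_sub,
    show k - m = -m + k by ring]
  exact this

/-- Lets a coefficient at a state with `k` filled be read off after removing `k`, as the induction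
for injectivity requires. -/
theorem psiStar_apply {k : ℤ} {S : Maya} (h : k ∉ S.1) (V : Fock) :
    psiStar k V S = S.sign k * V (S.insert k) := by
  classical
  have : Finsupp.lapply S ∘ₗ psiStar k = S.sign k • Finsupp.lapply (S.insert k) := by
    refine fock_hom_ext fun T => ?_
    rw [LinearMap.comp_apply, psiStar_ket]
    by_cases hT : T = S.insert k
    · subst hT
      rw [if_pos (show k ∈ (S.insert k).1 from Or.inl rfl), Maya.erase_insert h,
        Maya.sign_insert h]
      simp [ket]
    · split_ifs with hk
      · have : T.erase k ≠ S := fun h' => hT (by rw [← h', Maya.insert_erase hk])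
        simp [ket, Finsupp.single_eq_of_ne' this, Finsupp.single_eq_of_ne' hT]
      · simp [ket, Finsupp.single_eq_of_ne' hT]
  exact LinearMap.congr_fun this V

theorem Phi_injective : Function.Injective Phi := by
  change Function.Injective PhiHom
  rw [injective_iff_map_eq_zero]
  intro U hU
  have hK : ∀ V ∈ {V | Phi V = 0}, ∀ k : ℕ+, J k V ∈ {V | Phi V = 0} := by
    intro V hV k
    have hV' : Phi V = 0 := hV
    change Phi (J k V) = 0
    rw [Phi_J_pos, hV', map_zero]
  have h0 : ∀ n, ∀ V ∈ {V | Phi V = 0}, bra n V = 0 := by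
    intro n V hV
    have hV' : Phi V = 0 := hV
    have := coeff_Phi V n 0
    rw [hV', expTimes_zero] at this
    simpa using this.symm
  -- `⟨n| ψ*(z)` is `⟨n+1|` times a series in the `J_k`, `k > 0`, and these preserve the kernel, on
  -- which every `⟨n|` vanishes.
  have hpsi : ∀ m V, Phi V = 0 → Phi (psiStar m V) = 0 := by
    intro m V hV
    have := Phi_eq_zero_of_bra_eq_zero hK (T := fun m V => psiStarField V m) (ε := -1)
      (fun k m V => J_psiStarField k m V) (fun n m V hV => ?_) hV (-m)
    · simpa [psiStarField] using this
    · rw [bra_psiStarField, atZInv]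
      rcases lt_or_ge (-(m + n)) 0 with h | h
      · rw [atZ_of_neg _ h]; simp
      · obtain ⟨j, hj⟩ : ∃ j : ℕ, (j : ℤ) = -(m + n) := ⟨(-(m + n)).toNat, by omega⟩
        rw [← hj, atZ_formalExp_natCast, ← smul_Jplus_one]
        exact bra_expJplus_eq_zero hK h0 _ _ _ hV
  -- Induction on the number of particles above the filled sea `{k | k < a}`. Up to sign, the
  -- coefficient at `S` is that of `ψ*_s V` at `S` without `s`.
  have key : ∀ (c : ℕ) (a : ℤ) (S : Maya), Set.Iio a ⊆ S.1 → (S.1 \ Set.Iio a).Finite →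
      (S.1 \ Set.Iio a).ncard = c → ∀ V, Phi V = 0 → V S = 0 := by
    intro c a
    induction c with
    | zero =>
      intro S hS hf hc V hV
      rw [Set.ncard_eq_zero hf, Set.sdiff_eq_empty] at hc
      have : S = Maya.vac a := Subtype.ext (hc.antisymm hS)
      rw [this]
      exact h0 a V hV
    | succ c ih =>
      intro S hS hf hc V hV
      obtain ⟨s, hs⟩ : (S.1 \ Set.Iio a).Nonempty := by
        rw [← Set.ncard_pos hf]; omega
      have e : (S.erase s).1 \ Set.Iio a = (S.1 \ Set.Iio a) \ {s} := by
        rw [Maya.erase_val, Set.sdiff_sdiff_comm]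
      have h1 := ih (S.erase s)
        (fun x hx => ⟨hS hx, fun h => hs.2 (by rw [Set.mem_singleton_iff] at h; rwa [← h])⟩)
        (by rw [e]; exact hf.sdiff) (by rw [e, Set.ncard_sdiff_singleton_of_mem hs, hc]; rfl)
        (psiStar s V) (hpsi s V hV)
      rw [psiStar_apply (fun h : s ∈ (S.erase s).1 => h.2 rfl), Maya.insert_erase hs.1] at h1
      refine (mul_eq_zero.1 h1).resolve_left fun h => ?_
      have := (S.erase s).sign_mul_self s
      rw [h, mul_zero] at this
      exact zero_ne_one this
  refine Finsupp.ext fun S => ?_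
  obtain ⟨a, b, ha, hb⟩ := S.2
  exact key _ a S ha ((Set.finite_Ico a b).subset fun x hx => ⟨not_lt.1 hx.2, hb hx.1⟩) rfl U hU

end Correspondence

/-! ### Bosonization -/

section Bosonization

theorem locallyFinite_chargeProj : LocallyFinite chargeProj := by
  intro U
  refine (U.hasFiniteSupport.image Maya.charge).subset fun c hc => ?_
  obtain ⟨S, hS⟩ := Finsupp.ne_iff.1 hc
  rw [chargeProj_apply] at hS
  split_ifs at hS with h
  · exact ⟨S, hS, h⟩
  · exact absurd rfl hS

theorem locallyFinite_expP_zQ : LocallyFinite expP_zQ := fun U =>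
  (locallyFinite_chargeProj U).subset fun m hm h => hm <| by
    simp only at h ⊢
    rw [expP_zQ, Module.End.mul_apply, h, map_zero]

theorem locallyFinite_zQ_expP : LocallyFinite zQ_expP := fun U =>
  (locallyFinite_chargeProj (expP (-1) U)).preimage (f := fun m => -m) neg_injective.injOn

theorem J_commute_expP_zQ (k : ℕ+) (m : ℤ) : Commute (J k) (expP_zQ m) :=
  (J_commute_expP (by have := k.pos; omega) 1).mul_right (J_commute_chargeProj k m)

theorem J_commute_zQ_expP (k : ℕ+) (m : ℤ) : Commute (J k) (zQ_expP m) :=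
  (J_commute_chargeProj k (-m)).mul_right (J_commute_expP (by have := k.pos; omega) (-1))

theorem commute_atZInv_formalExp_Jplus {x : Module.End ℂ Fock} (h : ∀ k : ℕ+, Commute x (J k))
    (ε : ℂ) (m : ℤ) : Commute x (atZInv (formalExp (ε • Jplus)) m) := by
  rw [atZInv]
  rcases lt_or_ge (-m) 0 with hm | hm
  · rw [atZ_of_neg _ hm]; exact Commute.zero_right _
  · obtain ⟨j, hj⟩ : ∃ j : ℕ, (j : ℤ) = -m := ⟨(-m).toNat, by omega⟩
    rw [← hj, atZ_formalExp_natCast]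
    exact commute_expJplus h ε j

theorem J_commutator_atZ_formalExp_Jminus (k : ℕ+) (ε : ℂ) (m : ℤ) :
    J k * atZ (formalExp (ε • Jminus)) m - atZ (formalExp (ε • Jminus)) m * J k =
      ε • atZ (formalExp (ε • Jminus)) (m - k) := by
  rcases lt_or_ge m 0 with hm | hm
  · rw [atZ_of_neg _ hm, atZ_of_neg _ (show m - k < 0 by have := k.pos; omega)]; simp
  · lift m to ℕ using hm
    rw [atZ_formalExp_natCast]
    refine (commutator_J_expJminus ε k m).trans ?_
    split_ifs with h
    · rw [← Nat.cast_sub h, atZ_formalExp_natCast]; rfl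
    · rw [atZ_of_neg _ (by omega), smul_zero]

theorem bra_atZ_formalExp_Jminus (n : ℤ) (ε : ℂ) (m : ℤ) (U : Fock) :
    bra n (atZ (formalExp (ε • Jminus)) m U) = if m = 0 then bra n U else 0 := by
  rcases lt_or_ge m 0 with hm | hm
  · rw [atZ_of_neg _ hm, if_neg (by omega)]; simp
  · lift m to ℕ using hm
    rw [atZ_formalExp_natCast, if_congr Nat.cast_eq_zero rfl rfl]
    exact bra_expJminus n ε m U

/-- The left vacuum absorbs the leftmost factor, since `⟨n| e^{ε J_-([z])} = ⟨n|`. -/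
theorem bra_prod₃ {B C : ℤ → Module.End ℂ Fock} (hB : LocallyFinite B) (hC : LocallyFinite C)
    (ε : ℂ) (n m : ℤ) (U : Fock) :
    bra n (prod₃ (atZ (formalExp (ε • Jminus))) B C U m) = ∑ᶠ a, bra n (B a (C (m - a) U)) := by
  rw [prod₃, act, ← LinearMap.toAddMonoidHom_coe, AddMonoidHom.map_finsum _
    (composable_of_finite _ (hB.act_act_const_support_finite hC U) m), finsum_eq_single _ 0]
  · rw [LinearMap.toAddMonoidHom_coe, bra_atZ_formalExp_Jminus, if_pos rfl, sub_zero, act,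
      ← LinearMap.toAddMonoidHom_coe, AddMonoidHom.map_finsum _
      (composable_of_finite _ (hC.act_support_finite (const_support_finite U)) m), act_const]
  · intro a ha
    rw [LinearMap.toAddMonoidHom_coe, bra_atZ_formalExp_Jminus, if_neg ha]

/-- A field with `[J_k, F(z)] = ε z ^ k F(z)` for `k > 0` is determined by the `⟨n| F(z)`. -/
theorem eq_prod₃_of_bra {F : Fock → ℤ → Fock} {B C : ℤ → Module.End ℂ Fock} {ε : ℂ}
    (hB : LocallyFinite B) (hC : LocallyFinite C) (hJB : ∀ (k : ℕ+) m, Commute (J k) (B m))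
    (hJC : ∀ (k : ℕ+) m, Commute (J k) (C m))
    (hF : ∀ (k : ℕ+) m U, J k (F U m) = F (J k U) m + ε • F U (m - k))
    (h : ∀ n m U, bra n (F U m) = ∑ᶠ a, bra n (B a (C (m - a) U))) (U : Fock) :
    F U = prod₃ (atZ (formalExp (ε • Jminus))) B C U := by
  funext m
  rw [← sub_eq_zero]
  apply Phi_injective
  rw [show Phi 0 = 0 from map_zero PhiHom]
  -- The difference of the two fields obeys the same commutation rule and is annihilated by every
  -- left vacuum, so no restriction on the vectors is needed.
  refine Phi_eq_zero_of_bra_eq_zero (K := Set.univ) (fun _ _ _ => Set.mem_univ _)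
    (T := fun m U => F U m - prod₃ (atZ (formalExp (ε • Jminus))) B C U m) (ε := ε)
    (fun k m U => ?_) (fun n m U _ => ?_) (Set.mem_univ U) m
  · rw [map_sub, hF, commutator_prod₃ hB hC (J_commutator_atZ_formalExp_Jminus k ε) (hJB k)
      (hJC k), smul_sub]
    abel
  · rw [map_sub, h, bra_prod₃ hB hC, sub_self]

theorem psiField_eq_expPhi (U : Fock) : psiField U = expPhi U := by
  have hC := locallyFinite_expJplus (-1)
  have hJC := fun (k : ℕ+) m => commute_atZInv_formalExp_Jplus (x := J k)
    (fun _ => J_commute_of_pos (by positivity) (by positivity)) (-1) m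
  rw [smul_Jplus_neg_one] at hC hJC
  rw [expPhi, ← smul_Jminus_one]
  refine eq_prod₃_of_bra locallyFinite_expP_zQ hC J_commute_expP_zQ hJC
    (fun k m U => J_psiField k m U) (fun n m U => ?_) U
  -- `⟨n| e^P = ⟨n-1|`, so `z^Q` contributes only `z^{n-1}`.
  rw [bra_psiField, finsum_eq_single _ (n - 1)]
  · rw [expP_zQ, Module.End.mul_apply, bra_expP, bra_chargeProj, if_pos rfl]
  · intro a ha
    rw [expP_zQ, Module.End.mul_apply, bra_expP, bra_chargeProj, if_neg ha.symm]

theorem psiStarField_eq_expNegPhi (U : Fock) : psiStarField U = expNegPhi U := by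
  have hC := locallyFinite_expJplus 1
  have hJC := fun (k : ℕ+) m => commute_atZInv_formalExp_Jplus (x := J k)
    (fun _ => J_commute_of_pos (by positivity) (by positivity)) 1 m
  rw [smul_Jplus_one] at hC hJC
  rw [expNegPhi, ← smul_Jminus_neg_one]
  refine eq_prod₃_of_bra locallyFinite_zQ_expP hC J_commute_zQ_expP hJC
    (fun k m U => J_psiStarField k m U) (fun n m U => ?_) U
  -- Here `z^{-Q}` acts on `⟨n|` before the shift does, hence the exponent `-n`.
  rw [bra_psiStarField, finsum_eq_single _ (-n)]
  · rw [zQ_expP, Module.End.mul_apply, bra_chargeProj, neg_neg, if_pos rfl, bra_expP,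
      sub_neg_eq_add, sub_neg_eq_add]
  · intro a ha
    rw [zQ_expP, Module.End.mul_apply, bra_chargeProj, if_neg (by omega)]

end Bosonization

/-! ### Vertex operators -/

section VertexOperators

theorem J_ket_vac (k : ℕ+) (l : ℤ) : J k (ket (Maya.vac l)) = 0 := by
  have := k.pos
  rw [J_apply]
  refine finsum_eq_zero_of_forall_eq_zero fun j => ?_
  rw [normalOrdered_of_ne (by omega), Module.End.mul_apply]
  rcases lt_or_ge j l with h | h
  · exact psi_psiStar_ket_of_mem h (by omega)
  · rw [psiStar_ket_of_notMem (by rw [Maya.mem_vac]; omega), map_zero]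

theorem expTimes_ket_vac (d : ℕ+ →₀ ℕ) (l : ℤ) :
    expTimes d (ket (Maya.vac l)) = if d = 0 then ket (Maya.vac l) else 0 := by
  induction d using single_add_induction with
  | h0 => rw [expTimes_zero, if_pos rfl]; rfl
  | h d k _ =>
    have hd : ((d k + 1 : ℕ) : ℂ) ≠ 0 := by exact_mod_cast (d k).succ_ne_zero
    have h1 := LinearMap.congr_fun (expTimes_rec k d) (ket (Maya.vac l))
    rw [(commute_J_expTimes k d).eq, Module.End.mul_apply, J_ket_vac, map_zero,
      LinearMap.smul_apply, smul_eq_zero] at h1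
    rw [h1.resolve_left hd, if_neg]
    intro h
    have := DFunLike.congr_fun h k
    simp at this

theorem Phi_ket_vac (l : ℤ) : Phi (ket (Maya.vac l)) = LaurentPolynomial.T l := by
  classical
  refine bosonFock_ext fun j d => ?_
  rw [coeff_Phi, expTimes_ket_vac, LaurentPolynomial.T_apply]
  by_cases hj : l = j
  · subst hj
    rw [if_pos rfl, MvPolynomial.coeff_one]
    by_cases hd : d = 0
    · simp [hd, bra_ket]
    · simp [hd, Ne.symm hd]
  · rw [if_neg hj, MvPolynomial.coeff_zero]
    have : Maya.vac l ≠ Maya.vac j := fun h => hj (Maya.vac_injective h)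
    split_ifs <;> simp [bra_ket, this]

/-- The vacua map to the powers of `w`, and the range is stable under multiplication by `t_k`, which
is the image of `J_{-k} / k`. -/
theorem Phi_surjective : Function.Surjective Phi := by
  suffices h : LinearMap.range PhiHom = ⊤ from LinearMap.range_eq_top.1 h
  rw [eq_top_iff]
  intro f _
  have htime : ∀ (k : ℕ+), ∀ g ∈ LinearMap.range PhiHom, time k * g ∈ LinearMap.range PhiHom := by
    rintro k _ ⟨U, rfl⟩
    have hk : (k : ℂ) ≠ 0 := by exact_mod_cast k.pos.ne'
    rw [← Submodule.smul_mem_iff _ hk]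
    exact ⟨J (-k) U, Phi_J_neg k U⟩
  have hmon : ∀ (p : MvPolynomial ℕ+ ℂ) (l : ℤ),
      LaurentPolynomial.C p * LaurentPolynomial.T l ∈ LinearMap.range PhiHom := by
    intro p l
    induction p using MvPolynomial.induction_on with
    | C a =>
      have : (LaurentPolynomial.C (MvPolynomial.C a) * LaurentPolynomial.T l : BosonFock) =
          a • LaurentPolynomial.T l := by
        rw [← LaurentPolynomial.single_eq_C_mul_T]
        refine bosonFock_ext fun j d => ?_
        rw [AddMonoidAlgebra.coeff_single, Finsupp.single_apply,
          AddMonoidAlgebra.coeff_smul_apply, LaurentPolynomial.T_apply]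
        split_ifs <;> simp [MvPolynomial.coeff_C, MvPolynomial.coeff_one]
      rw [this]
      exact Submodule.smul_mem _ _ ⟨_, Phi_ket_vac l⟩
    | add p q hp hq =>
      rw [map_add, add_mul]
      exact add_mem hp hq
    | mul_X p k hp =>
      rw [mul_comm p, map_mul, mul_assoc]
      exact htime k _ hp
  induction f using LaurentPolynomial.induction_on' with
  | add f g hf hg => exact add_mem (hf trivial) (hg trivial)
  | C_mul_T l p => exact hmon p l

theorem Phi_atZ {ε : ℂ} {a : ℕ+ → Module.End ℂ Fock} {b : ℕ+ → Module.End ℂ BosonFock}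
    (h : ∀ k v, PhiHom (a k v) = b k (PhiHom v)) (m : ℤ) (U : Fock) :
    PhiHom (atZ (formalExp (ε • xi a)) m U) = atZ (formalExp (ε • xi b)) m (PhiHom U) := by
  rcases lt_or_ge m 0 with hm | hm
  · rw [atZ_of_neg _ hm, atZ_of_neg _ hm]; simp
  · lift m to ℕ using hm
    rw [atZ_formalExp_natCast, atZ_formalExp_natCast]
    exact intertwine_expCoeff PhiHom h m U

theorem Phi_atZ_Jminus (ε : ℂ) (m : ℤ) (U : Fock) :
    PhiHom (atZ (formalExp (ε • Jminus)) m U) = atZ (formalExp (ε • xiTime)) m (PhiHom U) := by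
  refine Phi_atZ (fun k v => ?_) m U
  have hk : (k : ℂ) ≠ 0 := by exact_mod_cast k.pos.ne'
  rw [LinearMap.smul_apply, map_smul, PhiHom_apply, Phi_J_neg, smul_smul, inv_mul_cancel₀ hk,
    one_smul]
  rfl

theorem Phi_atZInv_Jplus (ε : ℂ) (m : ℤ) (U : Fock) :
    PhiHom (atZInv (formalExp (ε • Jplus)) m U) = atZInv (formalExp (ε • xiD)) m (PhiHom U) := by
  refine Phi_atZ (fun k v => ?_) (-m) U
  rw [LinearMap.smul_apply, map_smul, PhiHom_apply, Phi_J_pos]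
  rfl

theorem Phi_expP_zQ (m : ℤ) (U : Fock) : PhiHom (expP_zQ m U) = bExpP_zQ m (PhiHom U) := by
  rw [expP_zQ, bExpP_zQ, Module.End.mul_apply, Module.End.mul_apply, PhiHom_apply, Phi_expP,
    Phi_chargeProj, PhiHom_apply]

theorem Phi_zQ_expP (m : ℤ) (U : Fock) : PhiHom (zQ_expP m U) = bzQ_expP m (PhiHom U) := by
  rw [zQ_expP, bzQ_expP, Module.End.mul_apply, Module.End.mul_apply, PhiHom_apply, Phi_chargeProj,
    Phi_expP, PhiHom_apply]

/-- Every bosonic vector is some `Φ(U)`, so finiteness need only be known on `Fock`, where energy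
and charge provide it. -/
theorem locallyFinite_of_Phi {A : ℤ → Module.End ℂ Fock} {A' : ℤ → Module.End ℂ BosonFock}
    (h : ∀ m U, PhiHom (A m U) = A' m (PhiHom U)) (hA : LocallyFinite A) : LocallyFinite A' := by
  intro f
  obtain ⟨U, rfl⟩ := Phi_surjective f
  refine (hA U).subset fun m hm h' => hm ?_
  simp only at h' ⊢
  rw [← PhiHom_apply, ← h, h', map_zero]

theorem commute_of_Phi {A B : Module.End ℂ Fock} {A' B' : Module.End ℂ BosonFock}
    (hA : ∀ U, PhiHom (A U) = A' (PhiHom U)) (hB : ∀ U, PhiHom (B U) = B' (PhiHom U))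
    (h : Commute A B) : Commute A' B' := by
  refine LinearMap.ext fun f => ?_
  obtain ⟨U, rfl⟩ := Phi_surjective f
  rw [Module.End.mul_apply, Module.End.mul_apply, ← PhiHom_apply, ← hA, ← hB, ← hA, ← hB,
    ← Module.End.mul_apply, h.eq, Module.End.mul_apply]

theorem smul_xiD_one : (1 : ℂ) • xiD = xiD := one_smul ℂ xiD

theorem smul_xiD_neg_one : (-1 : ℂ) • xiD = -xiD := by
  ext; simp

theorem smul_xiTime_one : (1 : ℂ) • xiTime = xiTime := one_smul ℂ xiTime

theorem smul_xiTime_neg_one : (-1 : ℂ) • xiTime = -xiTime := by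
  ext; simp

theorem locallyFinite_xiD (ε : ℂ) : LocallyFinite (atZInv (formalExp (ε • xiD))) :=
  locallyFinite_of_Phi (Phi_atZInv_Jplus ε) (locallyFinite_expJplus ε)

/-- `Φ` carries each factor to its bosonic counterpart. The two right factors are then exchanged,
which is legitimate because `B` commutes with `J_k` for `k > 0` and surjectivity transports
commutation. -/
theorem Phi_prod₃ {B : ℤ → Module.End ℂ Fock} {B' : ℤ → Module.End ℂ BosonFock}
    (hB : LocallyFinite B) (hJB : ∀ (k : ℕ+) m, Commute (J k) (B m))
    (hBB' : ∀ m U, PhiHom (B m U) = B' m (PhiHom U)) (ε δ : ℂ) (U : Fock) (m : ℤ) :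
    Phi (prod₃ (atZ (formalExp (ε • Jminus))) B (atZInv (formalExp (δ • Jplus))) U m) =
      prod₃ (atZ (formalExp (ε • xiTime))) (atZInv (formalExp (δ • xiD))) B' (Phi U) m := by
  rw [← PhiHom_apply, map_prod₃ PhiHom hB (locallyFinite_expJplus δ) (Phi_atZ_Jminus ε) hBB'
    (Phi_atZInv_Jplus δ), prod₃, prod₃, act_act_const_comm, PhiHom_apply]
  intro a b
  exact commute_of_Phi (hBB' a) (Phi_atZInv_Jplus δ b)
    (commute_atZInv_formalExp_Jplus (fun k => (hJB k a).symm) δ b)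

theorem Phi_psiField (U : Fock) : (fun m => Phi (psiField U m)) = vertexX (Phi U) := by
  funext m
  rw [psiField_eq_expPhi, expPhi, ← smul_Jminus_one, ← smul_Jplus_neg_one,
    Phi_prod₃ locallyFinite_expP_zQ J_commute_expP_zQ Phi_expP_zQ, smul_xiD_neg_one,
    smul_xiTime_one, vertexX]

theorem Phi_psiStarField (U : Fock) :
    (fun m => Phi (psiStarField U m)) = vertexXStar (Phi U) := by
  funext m
  rw [psiStarField_eq_expNegPhi, expNegPhi, ← smul_Jminus_neg_one, ← smul_Jplus_one,
    Phi_prod₃ locallyFinite_zQ_expP J_commute_zQ_expP Phi_zQ_expP, smul_xiD_one,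
    smul_xiTime_neg_one, vertexXStar]

end VertexOperators

end BosonFermion

end

open BosonFermion in
theorem mainTheorem4 :
    -- the sum defining `Φ` is finite: the coefficient of `w ^ l` in `Φ(U)` is `⟨l| e^{J_+(t)} |U⟩`
    (∀ (U : Fock) (l : ℤ), (((Phi U).coeff l : MvPolynomial ℕ+ ℂ) : MvPowerSeries ℕ+ ℂ) =
      amplitude l U) ∧
    -- the currents
    (∀ U : Fock,
      (∀ k : ℕ+, Phi (J k U) = dTime k (Phi U)) ∧
      Phi (J 0 U) = wdw (Phi U) ∧
      (∀ k : ℕ+, Phi (J (-k) U) = (k : ℂ) • (time k * Phi U))) ∧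
    -- the fermion fields are represented by the vertex operators, which are well defined
    WellDefined₃ (atZ (formalExp xiTime)) (atZInv (formalExp (-xiD))) bExpP_zQ ∧
    WellDefined₃ (atZ (formalExp (-xiTime))) (atZInv (formalExp xiD)) bzQ_expP ∧
    (∀ U : Fock,
      (fun m => Phi (psiField U m)) = vertexX (Phi U) ∧
      (fun m => Phi (psiStarField U m)) = vertexXStar (Phi U)) ∧
    -- the fermion fields as normally ordered exponentials of the bosonic field
    WellDefined₃ (atZ (formalExp Jminus)) expP_zQ (atZInv (formalExp (-Jplus))) ∧
    WellDefined₃ (atZ (formalExp (-Jminus))) zQ_expP (atZInv (formalExp Jplus)) ∧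
    (∀ U : Fock, psiField U = expPhi U ∧ psiStarField U = expNegPhi U) ∧
    -- the action on the left vacua: `⟨n| ψ(z) = z^{n-1} ⟨n-1| e^{-J_+([z⁻¹])}` and
    -- `⟨n| ψ*(z) = z^{-n} ⟨n+1| e^{J_+([z⁻¹])}`
    (∀ (n : ℤ) (U : Fock) (m : ℤ),
      bra n (psiField U m) = bra (n - 1) (atZInv (formalExp (-Jplus)) (m - (n - 1)) U) ∧
      bra n (psiStarField U m) = bra (n + 1) (atZInv (formalExp Jplus) (m + n) U)) := by
  refine ⟨coe_coeff_Phi, fun U => ⟨fun k => Phi_J_pos k U, Phi_J_zero U, fun k => Phi_J_neg k U⟩,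
    wellDefined₃_of_locallyFinite _ ?_ (locallyFinite_of_Phi Phi_expP_zQ locallyFinite_expP_zQ),
    wellDefined₃_of_locallyFinite _ ?_ (locallyFinite_of_Phi Phi_zQ_expP locallyFinite_zQ_expP),
    fun U => ⟨Phi_psiField U, Phi_psiStarField U⟩,
    wellDefined₃_of_locallyFinite _ locallyFinite_expP_zQ ?_,
    wellDefined₃_of_locallyFinite _ locallyFinite_zQ_expP ?_,
    fun U => ⟨psiField_eq_expPhi U, psiStarField_eq_expNegPhi U⟩,
    fun n U m => ⟨bra_psiField n m U, bra_psiStarField n m U⟩⟩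
  · rw [← smul_xiD_neg_one]; exact locallyFinite_xiD _
  · rw [← smul_xiD_one]; exact locallyFinite_xiD _
  · rw [← smul_Jplus_neg_one]; exact locallyFinite_expJplus _
  · rw [← smul_Jplus_one]; exact locallyFinite_expJplus _
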